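/- For integers $d,n,L\ge 1$, let $\mathbb T_L^d$ be the $d$-dimensional discrete torus of side length $2L$: its vertex set is $\Lambda=(\mathbb Z/2L\mathbb Z)^d$ (identified with $\{-L+1,\dots,L\}^d$), and $u,v\in\Lambda$ are adjacent if they are equal in all but one coordinate and differ by exactly $1$ modulo $2L$ in that coordinate. The spin $O(n)$ model on $\mathbb T_L^d$ at inverse temperature $\beta\ge 0$ is the probability measure on configurations $\sigma:\Lambda\to\mathbb S^{n-1}$, where $\mathbb S^{n-1}\subseteq\mathbb R^n$ is the unit sphere, with $$d\mu(\sigma)=\frac1Z\exp\Big[\beta\sum_{\{u,v\}\in E(\mathbb T_L^d)}\langle\sigma_u,\sigma_v\rangle\Big]\,d\sigma,$$ where $E(\mathbb T_L^d)$ is the set of edges (unordered pairs of adjacent vertices), $d\sigma$ is the product of the uniform probability measures on $\mathbb S^{n-1}$, and $Z$ is the normalizing constant. Let $\mathbb E$ denote expectation with respect to $\mu$, and put $$A_{d,n,\beta}(L)=\frac1{|\Lambda|^2}\sum_{x,y\in\Lambda}\mathbb E\,\langle\sigma_x,\sigma_y\rangle,\qquad I_d=\int_{[0,1]^d}\frac{dt}{\sum_{j=1}^d(1-\cos(\pi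 t_j))}\in[0,\infty].$$ Theorem. 1. For all $d\ge 3$ and $n\ge 1$ there is $\beta_1=\beta_1(d,n)>0$ such that for every $\beta\ge\beta_1$ there is a constant $c_{d,n,\beta}>0$ with $A_{d,n,\beta}(L)\ge c_{d,n,\beta}$ for all $L\ge 1$. 2. For all $d\ge 1$, $n\ge 1$ and $\beta>0$, $$\liminf_{L\to\infty}A_{d,n,\beta}(L)\ \ge\ 1-\frac{n}{2\beta}\,I_d,$$ where the right-hand side is $-\infty$ if $I_d=\infty$. 3. $I_d<\infty$ for all $d\ge 3$, and $I_d\sim 1/d$ as $d\to\infty$, that is, $\lim_{d\to\infty} d\,I_d=1$. -/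

import Mathlib

open MeasureTheory Filter Topology Asymptotics

/-- The unit sphere `S^{n-1}` of Euclidean `ℝⁿ` (for `n = 1` the two points `±1`). -/
abbrev SpinSphere (n : ℕ) : Type :=
  Metric.sphere (0 : EuclideanSpace ℝ (Fin n)) 1

/-- The uniform probability measure on `S^{n-1}`: normalized surface measure. -/
noncomputable def sphereUniform (n : ℕ) : Measure (SpinSphere n) :=
  ((volume : Measure (EuclideanSpace ℝ (Fin n))).toSphere Set.univ)⁻¹ •
    (volume : Measure (EuclideanSpace ℝ (Fin n))).toSphere

/-- The inner product `⟨σ_u, σ_v⟩` attached to an unordered pair `{u, v}`. -/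
noncomputable def pairInner {V : Type*} {n : ℕ} (σ : V → SpinSphere n) : Sym2 V → ℝ :=
  Sym2.lift ⟨fun u v => inner ℝ (σ u : EuclideanSpace ℝ (Fin n)) (σ v),
    fun _ _ => real_inner_comm _ _⟩

open Classical in
/-- The sum of `⟨σ_u, σ_v⟩` over the edges `{u, v}` of `G`, each edge being counted once. -/
noncomputable def edgeInnerSum {V : Type*} [Fintype V] (G : SimpleGraph V) {n : ℕ}
    (σ : V → SpinSphere n) : ℝ :=
  ∑ e ∈ G.edgeFinset, pairInner σ e

/-- The spin `O(n)` model on the finite graph `G` at inverse temperature `β`: the measure with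
density `exp (β ∑_{{u,v} ∈ E(G)} ⟨σ_u, σ_v⟩) / Z` with respect to the product of the uniform
probability measures on the spheres, where `Z` is the integral of the exponential
(this normalization is part of `Measure.tilted`). -/
noncomputable def spinMeasure {V : Type*} [Fintype V] (G : SimpleGraph V) (n : ℕ) (β : ℝ) :
    Measure (V → SpinSphere n) :=
  (Measure.pi fun _ : V => sphereUniform n).tilted fun σ => β * edgeInnerSum G σ

/-- The correlation `E ⟨σ_x, σ_y⟩` in the spin `O(n)` model. -/
noncomputable def spinCorrelation {V : Type*} [Fintype V] (G : SimpleGraph V) (n : ℕ) (β : ℝ)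
    (x y : V) : ℝ :=
  ∫ σ, inner ℝ (σ x : EuclideanSpace ℝ (Fin n)) (σ y) ∂(spinMeasure G n β)

/-- The averaged correlation `|V|⁻² ∑_{x,y} E ⟨σ_x, σ_y⟩`. -/
noncomputable def averagedCorrelation {V : Type*} [Fintype V] (G : SimpleGraph V) (n : ℕ)
    (β : ℝ) : ℝ :=
  ((Fintype.card V : ℝ) ^ 2)⁻¹ * ∑ x : V, ∑ y : V, spinCorrelation G n β x y

/-- The `d`-dimensional discrete torus of side length `2L`. The representatives
`-L+1, …, L` of the coordinates are identified with their residue classes modulo `2L`; two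
vertices are adjacent when they agree in all but one coordinate and differ by exactly one
modulo `2L` in that coordinate. -/
def torusGraph (d : ℕ) (L : ℕ) : SimpleGraph (Fin d → ZMod (2 * L)) where
  Adj u v := ∃ j, (u j - v j = 1 ∨ v j - u j = 1) ∧ ∀ i, i ≠ j → u i = v i
  symm := ⟨by
    rintro u v ⟨j, h, h'⟩
    exact ⟨j, h.symm, fun i hi => (h' i hi).symm⟩⟩
  loopless := ⟨by
    rintro u ⟨j, h, -⟩
    have : Nontrivial (ZMod (2 * L)) := ZMod.nontrivial_iff.2 (by omega)
    simp at h⟩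

/-- The value in `[0, ∞]` of `∫_{[0,1]^d} (∑_j (1 - cos (π t_j)))⁻¹ dt`. -/
noncomputable def infraredIntegral (d : ℕ) : ENNReal :=
  ∫⁻ t in Set.Icc (0 : Fin d → ℝ) 1, (ENNReal.ofReal (∑ j, (1 - Real.cos (Real.pi * t j))))⁻¹

/-! The argument is the infrared bound of Fröhlich, Simon and Spencer. For unit spins, `β` times the
edge sum equals a constant minus `β / 4` times the Dirichlet energy of `σ`. Let `Z(h)` be the
partition function with `σ` replaced by `σ + h` in that energy.

Reflection positivity: a mirror cutting the torus through edge midpoints splits the energy into two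
halves and a Gaussian coupling across the cut. The Gaussian kernel is a Gram kernel, so
Cauchy–Schwarz bounds `Z(h)²` by the product of the `Z` of the two shifts obtained by reflecting
either half of `h` onto the other (`shiftedPartition_sq_le`). Among maximizers of `Z`, one with the
fewest edges of unequal shift must have none, since folding along a mirror through such an edge
would lower the count. Hence `Z(h) ≤ Z(0)` (`shiftedPartition_le_zero_shift`).

To second order in `h` this bounds the variance of the Dirichlet form of `σ` against `h`. For `h` a
Fourier mode `k ≠ 0` of eigenvalue `2λ_k` it bounds the structure factor by `n N / (2β λ_k)`, with
`N = (2L)^d`. By Parseval the structure factors sum to exactly `N²`, so what the modes `k ≠ 0`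
cannot carry lies in `k = 0`, which is `N²` times the averaged correlation
(`one_sub_le_averagedCorrelation`).

The mean of `1 / λ_k` is a Riemann sum that converges to `I_d` by dominated convergence when `I_d`
is finite; this gives part 2. Part 1 follows for `β > n I_d / 2`, the finitely many small `L` being
covered by strict positivity of the averaged correlation.

For part 3, write `1 / x = ∫ exp (-s x) ds`; the coordinates decouple and `I_d = ∫ φ(s)^d ds`, where
`φ` is `cosLaplace`. Since `φ(s) ≤ (1 + 4s/3)^(-1/2)`, the integral is finite for `d ≥ 3`, and `d
I_d = ∫ φ(s/d)^d ds → ∫ exp (-s) ds = 1` because `1 - cos (π u)` has mean one. -/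

/-- Cauchy–Schwarz for an integral kernel of Gram type. -/
lemma lintegral_gram_sq_le {X W : Type*} [MeasurableSpace X] [MeasurableSpace W]
    (μ : Measure X) (ρ : Measure W) [SFinite μ] [SFinite ρ] {f g : X → W → ENNReal}
    (hf : Measurable (Function.uncurry f)) (hg : Measurable (Function.uncurry g)) :
    (∫⁻ x, ∫⁻ y, ∫⁻ w, f x w * g y w ∂ρ ∂μ ∂μ) ^ 2 ≤
      (∫⁻ x, ∫⁻ y, ∫⁻ w, f x w * f y w ∂ρ ∂μ ∂μ) *
        (∫⁻ x, ∫⁻ y, ∫⁻ w, g x w * g y w ∂ρ ∂μ ∂μ) := by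
  have key : ∀ {f g : X → W → ENNReal}, Measurable (Function.uncurry f) →
      Measurable (Function.uncurry g) →
      ∫⁻ x, ∫⁻ y, ∫⁻ w, f x w * g y w ∂ρ ∂μ ∂μ =
        ∫⁻ w, (∫⁻ x, f x w ∂μ) * (∫⁻ y, g y w ∂μ) ∂ρ := by
    intro f g hf hg
    have hg' : Measurable fun w => ∫⁻ y, g y w ∂μ := hg.lintegral_prod_left'
    have hfx : ∀ x, Measurable (f x) := fun x => hf.comp measurable_prodMk_left
    have hfw : ∀ w, Measurable fun x => f x w := fun w => hf.comp measurable_prodMk_right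
    have hgw : ∀ w, Measurable fun x => g x w := fun w => hg.comp measurable_prodMk_right
    have h1 : ∀ x, ∫⁻ y, ∫⁻ w, f x w * g y w ∂ρ ∂μ = ∫⁻ w, f x w * ∫⁻ y, g y w ∂μ ∂ρ := by
      intro x
      rw [lintegral_lintegral_swap]
      · refine lintegral_congr fun w => ?_
        rw [lintegral_const_mul _ (hgw w)]
      · exact (((hfx x).comp measurable_snd).mul hg).aemeasurable
    simp_rw [h1]
    rw [lintegral_lintegral_swap]
    · refine lintegral_congr fun w => ?_
      rw [lintegral_mul_const _ (hfw w)]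
    · exact (hf.mul (hg'.comp measurable_snd)).aemeasurable
  rw [key hf hg, key hf hf, key hg hg]
  have hF : Measurable fun w => ∫⁻ y, f y w ∂μ := hf.lintegral_prod_left'
  have hG : Measurable fun w => ∫⁻ y, g y w ∂μ := hg.lintegral_prod_left'
  have h := ENNReal.lintegral_mul_le_Lp_mul_Lq ρ Real.HolderConjugate.two_two
    hF.aemeasurable hG.aemeasurable
  calc _ ≤ _ := pow_le_pow_left' h 2
    _ = _ := by
      rw [mul_pow, ← ENNReal.rpow_natCast, ← ENNReal.rpow_natCast, ← ENNReal.rpow_mul,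
        ← ENNReal.rpow_mul]
      norm_num
      simp_rw [sq]

/-! ### Graph reflections and foldings. -/

section Reflection

open Classical in
/-- The sum of `F (τ u) (τ v)` over the ordered pairs of adjacent vertices. -/
noncomputable def adjSum {V α M : Type*} [Fintype V] [AddCommMonoid M] (G : SimpleGraph V)
    (F : α → α → M) (τ : V → α) : M :=
  ∑ u, ∑ v, if G.Adj u v then F (τ u) (τ v) else 0

/-- A splitting of the vertex set into two halves exchanged by a reflection of the graph, such
that an edge between the halves joins a vertex to its mirror image. -/
structure MirrorSplitting {V : Type*} (G : SimpleGraph V) (T : Type*) where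
  toEquiv : T ⊕ T ≃ V
  adj_inr_inr : ∀ a b, G.Adj (toEquiv (.inr a)) (toEquiv (.inr b)) ↔
    G.Adj (toEquiv (.inl a)) (toEquiv (.inl b))
  eq_of_adj : ∀ a b, G.Adj (toEquiv (.inl a)) (toEquiv (.inr b)) → a = b

namespace MirrorSplitting

variable {V T : Type*} {G : SimpleGraph V}

/-- The graph induced on a half. -/
def half (s : MirrorSplitting G T) : SimpleGraph T := G.comap fun a => s.toEquiv (.inl a)

/-- The map to the left half that folds the right half. -/
def foldLeft (s : MirrorSplitting G T) (v : V) : V :=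
  s.toEquiv (.inl ((s.toEquiv.symm v).elim id id))

/-- The map to the right half that folds the left half. -/
def foldRight (s : MirrorSplitting G T) (v : V) : V :=
  s.toEquiv (.inr ((s.toEquiv.symm v).elim id id))

-- Edges inside the right half mirror those inside the left one, and a crossing edge joins mirror
-- images; it occurs in both orders, whence the factor 2.
open Classical in
lemma adjSum_eq [Fintype V] [Fintype T] (s : MirrorSplitting G T) {α M : Type*}
    [AddCommMonoid M] {F : α → α → M} (hF : ∀ x y, F x y = F y x) (τ : V → α) :
    adjSum G F τ = adjSum s.half F (fun a => τ (s.toEquiv (.inl a))) +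
      adjSum s.half F (fun a => τ (s.toEquiv (.inr a))) +
      2 • ∑ a, if G.Adj (s.toEquiv (.inl a)) (s.toEquiv (.inr a)) then
        F (τ (s.toEquiv (.inl a))) (τ (s.toEquiv (.inr a))) else 0 := by
  unfold adjSum
  rw [← s.toEquiv.sum_comp, Fintype.sum_sum_type]
  simp_rw [← s.toEquiv.sum_comp (fun v => if G.Adj _ v then F _ (τ v) else 0),
    Fintype.sum_sum_type, Finset.sum_add_distrib]
  have h1 : ∀ a, ∑ b, (if G.Adj (s.toEquiv (.inl a)) (s.toEquiv (.inr b)) then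
      F (τ (s.toEquiv (.inl a))) (τ (s.toEquiv (.inr b))) else 0) =
      if G.Adj (s.toEquiv (.inl a)) (s.toEquiv (.inr a)) then
        F (τ (s.toEquiv (.inl a))) (τ (s.toEquiv (.inr a))) else 0 := by
    intro a
    rw [Finset.sum_eq_single a]
    · intro b _ hb
      rw [if_neg fun h => hb (s.eq_of_adj _ _ h).symm]
    · simp
  have h2 : ∀ a, ∑ b, (if G.Adj (s.toEquiv (.inr a)) (s.toEquiv (.inl b)) then
      F (τ (s.toEquiv (.inr a))) (τ (s.toEquiv (.inl b))) else 0) =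
      if G.Adj (s.toEquiv (.inl a)) (s.toEquiv (.inr a)) then
        F (τ (s.toEquiv (.inl a))) (τ (s.toEquiv (.inr a))) else 0 := by
    intro a
    rw [← h1 a]
    refine Finset.sum_congr rfl fun b _ => ?_
    by_cases hab : a = b
    · subst hab
      rw [G.adj_comm, hF]
    · rw [if_neg fun h => hab (s.eq_of_adj _ _ h.symm).symm,
        if_neg fun h => hab (s.eq_of_adj _ _ h)]
  simp_rw [h1, h2, s.adj_inr_inr, two_nsmul, half, SimpleGraph.comap_adj]
  abel

@[simp] lemma foldLeft_inl (s : MirrorSplitting G T) (a : T) :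
    s.foldLeft (s.toEquiv (.inl a)) = s.toEquiv (.inl a) := by simp [foldLeft]

@[simp] lemma foldLeft_inr (s : MirrorSplitting G T) (a : T) :
    s.foldLeft (s.toEquiv (.inr a)) = s.toEquiv (.inl a) := by simp [foldLeft]

@[simp] lemma foldRight_inl (s : MirrorSplitting G T) (a : T) :
    s.foldRight (s.toEquiv (.inl a)) = s.toEquiv (.inr a) := by simp [foldRight]

@[simp] lemma foldRight_inr (s : MirrorSplitting G T) (a : T) :
    s.foldRight (s.toEquiv (.inr a)) = s.toEquiv (.inr a) := by simp [foldRight]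

end MirrorSplitting

end Reflection

/-! ### Gaussian kernels as Gram kernels. -/

section GaussianKernel

variable {E : Type*} [NormedAddCommGroup E] [InnerProductSpace ℝ E] [FiniteDimensional ℝ E]
  [MeasurableSpace E] [BorelSpace E]

/-- The Gaussian kernel is a Gram kernel. -/
lemma exists_gaussian_gram {β : ℝ} (hβ : 0 < β) :
    ∃ c : ℝ, 0 < c ∧ ∀ x y : E, Real.exp (-(β / 2) * ‖x - y‖ ^ 2) =
      ∫ w, c * (Real.exp (-β * ‖x - w‖ ^ 2) * Real.exp (-β * ‖y - w‖ ^ 2)) := by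
  refine ⟨(∫ w : E, Real.exp (-(2 * β) * ‖w‖ ^ 2))⁻¹, inv_pos.2 ?_, fun x y => ?_⟩
  · rw [GaussianFourier.integral_rexp_neg_mul_sq_norm (by positivity)]
    positivity
  have hpos : (∫ w : E, Real.exp (-(2 * β) * ‖w‖ ^ 2)) ≠ 0 := by
    rw [GaussianFourier.integral_rexp_neg_mul_sq_norm (by positivity)]
    positivity
  -- With `m` the midpoint of `x` and `y`, the parallelogram law gives `‖x - w‖² + ‖y - w‖² = 2 ‖m -
  -- w‖² + ‖x - y‖² / 2`, so the integral over `w` separates.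
  rw [integral_const_mul, eq_inv_mul_iff_mul_eq₀ hpos,
    ← integral_sub_left_eq_self _ volume ((1 / 2 : ℝ) • (x + y)), ← integral_mul_const]
  congr 1
  ext w
  rw [← Real.exp_add, ← Real.exp_add]
  congr 1
  have hpar := parallelogram_law_with_norm ℝ (x - w) (y - w)
  have e1 : x - w + (y - w) = (2 : ℝ) • ((1 / 2 : ℝ) • (x + y) - w) := by
    module
  rw [e1, norm_smul, show x - w - (y - w) = x - y by abel] at hpar
  norm_num at hpar
  norm_num
  nlinarith

/-- A product of Gaussian kernels is a Gram kernel. -/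
lemma exists_gaussian_gram_prod (C : Type*) [Fintype C] {β : ℝ} (hβ : 0 < β) :
    ∃ g : (C → E) → (C → E) → ENNReal, Measurable (Function.uncurry g) ∧
      ∀ x y : C → E, ENNReal.ofReal (Real.exp (-(β / 2) * ∑ a, ‖x a - y a‖ ^ 2)) =
        ∫⁻ w, g x w * g y w := by
  obtain ⟨c, hc, h⟩ := exists_gaussian_gram (E := E) hβ
  refine ⟨fun x w => ENNReal.ofReal (∏ a, (√c * Real.exp (-β * ‖x a - w a‖ ^ 2))), ?_,
    fun x y => ?_⟩
  · unfold Function.uncurry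
    fun_prop
  have e1 : Real.exp (-(β / 2) * ∑ a, ‖x a - y a‖ ^ 2) = ∫ w : C → E,
      ∏ a, (c * (Real.exp (-β * ‖x a - w a‖ ^ 2) * Real.exp (-β * ‖y a - w a‖ ^ 2))) := by
    rw [Finset.mul_sum, Real.exp_sum, integral_fintype_prod_volume_eq_prod
      (f := fun a w => c * (Real.exp (-β * ‖x a - w‖ ^ 2) * Real.exp (-β * ‖y a - w‖ ^ 2)))]
    simp_rw [h]
  -- A Bochner integral defaults to 0 off integrable functions, so a nonzero value yields
  -- integrability.
  have hne : (∫ w : C → E, ∏ a, (c * (Real.exp (-β * ‖x a - w a‖ ^ 2) *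
      Real.exp (-β * ‖y a - w a‖ ^ 2)))) ≠ 0 := by
    rw [← e1]; positivity
  rw [e1, ofReal_integral_eq_lintegral_ofReal (Integrable.of_integral_ne_zero hne)
    (Eventually.of_forall fun w => Finset.prod_nonneg fun a _ => by positivity)]
  refine lintegral_congr fun w => ?_
  rw [← ENNReal.ofReal_mul (Finset.prod_nonneg fun a _ => by positivity),
    ← Finset.prod_mul_distrib]
  congr 1
  refine Finset.prod_congr rfl fun a _ => ?_
  nth_rewrite 1 [← Real.mul_self_sqrt hc.le]
  ring

end GaussianKernel

/-! ### Reflection positivity and Gaussian domination. -/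

section GaussianDomination

variable {V T X : Type*} [Fintype V] [Fintype T] [MeasurableSpace X]
variable {E : Type*} [NormedAddCommGroup E]

/-- The Dirichlet energy `∑ ‖τ u - τ v‖²` over ordered pairs of adjacent vertices. -/
noncomputable def dirichletEnergy (G : SimpleGraph V) (τ : V → E) : ℝ :=
  adjSum G (fun x y => ‖x - y‖ ^ 2) τ

lemma dirichletEnergy_nonneg (G : SimpleGraph V) (τ : V → E) : 0 ≤ dirichletEnergy G τ := by
  unfold dirichletEnergy adjSum
  exact Finset.sum_nonneg fun u _ => Finset.sum_nonneg fun v _ => by split_ifs <;> positivity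

lemma continuous_dirichletEnergy (G : SimpleGraph V) :
    Continuous (dirichletEnergy G : (V → E) → ℝ) := by
  unfold dirichletEnergy adjSum
  refine continuous_finsetSum _ fun u _ => continuous_finsetSum _ fun v _ => ?_
  split_ifs <;> fun_prop

/-- The partition function of the Gibbs measure with spins `p (σ v)` shifted by `h`. -/
noncomputable def shiftedPartition (G : SimpleGraph V) (β : ℝ) (ν : Measure X) (p : X → E)
    (h : V → E) : ENNReal :=
  ∫⁻ σ, ENNReal.ofReal (Real.exp (-(β / 4) * dirichletEnergy G fun v => p (σ v) + h v))
    ∂Measure.pi fun _ : V => ν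

lemma shiftedPartition_lt_top (G : SimpleGraph V) {β : ℝ} (hβ : 0 < β) (ν : Measure X)
    [IsFiniteMeasure ν] (p : X → E) (h : V → E) : shiftedPartition G β ν p h < ⊤ := by
  refine lt_of_le_of_lt (b := ∫⁻ _, 1 ∂Measure.pi fun _ : V => ν) (lintegral_mono fun σ => ?_) ?_
  · rw [ENNReal.ofReal_le_one, Real.exp_le_one_iff]
    have := dirichletEnergy_nonneg G fun v => p (σ v) + h v
    nlinarith
  · simp

lemma shiftedPartition_eq_zero_shift (G : SimpleGraph V) (β : ℝ) (ν : Measure X) (p : X → E)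
    {h : V → E} (hh : ∀ u v, G.Adj u v → h u = h v) :
    shiftedPartition G β ν p h = shiftedPartition G β ν p 0 := by
  unfold shiftedPartition dirichletEnergy adjSum
  congr 1
  ext σ
  congr 3
  refine Finset.sum_congr rfl fun u _ => Finset.sum_congr rfl fun v _ => ?_
  split_ifs with huv
  · simp [hh u v huv]
  · rfl

variable {G : SimpleGraph V}

-- The product measure factors over the halves. Crossing edges are counted twice in the energy, so
-- their coefficient is `β / 2`, the one of the Gram kernel.
open Classical in
lemma shiftedPartition_eq_lintegral_halves [MeasurableSpace E] [BorelSpace E]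
    [SecondCountableTopology E] (s : MirrorSplitting G T) (β : ℝ)
    (ν : Measure X) [SigmaFinite ν] {p : X → E} (hp : Measurable p) (h : V → E) :
    shiftedPartition G β ν p h = ∫⁻ x, ∫⁻ y,
      ENNReal.ofReal (Real.exp (-(β / 4) *
        dirichletEnergy s.half fun a => p (x a) + h (s.toEquiv (.inl a)))) *
      ENNReal.ofReal (Real.exp (-(β / 4) *
        dirichletEnergy s.half fun a => p (y a) + h (s.toEquiv (.inr a)))) *
      ENNReal.ofReal (Real.exp (-(β / 2) *
        ∑ a : {a // G.Adj (s.toEquiv (.inl a)) (s.toEquiv (.inr a))},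
          ‖(p (x a) + h (s.toEquiv (.inl a))) - (p (y a) + h (s.toEquiv (.inr a)))‖ ^ 2))
      ∂(Measure.pi fun _ : T => ν) ∂(Measure.pi fun _ : T => ν) := by
  have m1 := measurePreserving_piCongrLeft (α := fun _ : V => X) (fun _ => ν) s.toEquiv
  have m2 := measurePreserving_sumPiEquivProdPi_symm (X := fun _ : T ⊕ T => X) (fun _ => ν)
  have hDV : Measurable fun τ : V → E => dirichletEnergy G τ :=
    (continuous_dirichletEnergy G).measurable
  have hmeas : Measurable fun σ : V → X => ENNReal.ofReal
      (Real.exp (-(β / 4) * dirichletEnergy G fun v => p (σ v) + h v)) := by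
    have : Measurable fun (σ : V → X) (v : V) => p (σ v) + h v := by fun_prop
    exact ((((hDV.comp this)).const_mul _).exp).ennreal_ofReal
  unfold shiftedPartition
  rw [← (m1.comp m2).lintegral_comp hmeas]
  refine (lintegral_prod _ (hmeas.comp (m1.comp m2).measurable).aemeasurable).trans ?_
  refine lintegral_congr fun x => lintegral_congr fun y => ?_
  rw [Function.comp_apply, ← ENNReal.ofReal_mul (by positivity),
    ← ENNReal.ofReal_mul (by positivity), ← Real.exp_add, ← Real.exp_add]
  congr 2
  unfold dirichletEnergy
  rw [s.adjSum_eq (fun x y => by rw [norm_sub_rev])]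
  simp only [Function.comp_apply, MeasurableEquiv.coe_piCongrLeft,
    Equiv.piCongrLeft_apply_apply, MeasurableEquiv.coe_sumPiEquivProdPi_symm,
    Equiv.sumPiEquivProdPi_symm_apply]
  rw [← Finset.sum_filter, ← Finset.sum_subtype_eq_sum_filter, Finset.subtype_univ, two_nsmul]
  ring

variable [InnerProductSpace ℝ E] [FiniteDimensional ℝ E] [MeasurableSpace E] [BorelSpace E]

/-- Reflection positivity: folding the shift along a mirror. -/
lemma shiftedPartition_sq_le (s : MirrorSplitting G T) {β : ℝ} (hβ : 0 < β)
    (ν : Measure X) [SigmaFinite ν] {p : X → E} (hp : Measurable p) (h : V → E) :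
    shiftedPartition G β ν p h ^ 2 ≤
      shiftedPartition G β ν p (h ∘ s.foldLeft) * shiftedPartition G β ν p (h ∘ s.foldRight) := by
  classical
  obtain ⟨g, hg, hgram⟩ := exists_gaussian_gram_prod (E := E)
    {a // G.Adj (s.toEquiv (.inl a)) (s.toEquiv (.inr a))} hβ
  -- The weight of one half is absorbed into the Gram factor. By symmetry both halves use the same
  -- `f` and differ only in the shift `k`, so folding `h` means taking the same `k` twice.
  let f : (T → E) → (T → X) → ({a // G.Adj (s.toEquiv (.inl a)) (s.toEquiv (.inr a))} → E) →
      ENNReal := fun k x w =>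
    ENNReal.ofReal (Real.exp (-(β / 4) * dirichletEnergy s.half fun a => p (x a) + k a)) *
      g (fun a => p (x a) + k a) w
  have hD : Measurable fun τ : T → E => dirichletEnergy s.half τ :=
    (continuous_dirichletEnergy _).measurable
  have hf : ∀ k, Measurable (Function.uncurry (f k)) := by
    intro k
    have m1 : Measurable fun (x : T → X) (a : T) => p (x a) + k a := by fun_prop
    have m2 : Measurable fun (x : T → X)
      (a : {a // G.Adj (s.toEquiv (.inl a)) (s.toEquiv (.inr a))}) => p (x a) + k a := by fun_prop
    exact ((((hD.comp m1).comp measurable_fst).const_mul _).exp.ennreal_ofReal).mul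
      (hg.comp ((m2.comp measurable_fst).prodMk measurable_snd))
  have key : ∀ h : V → E, shiftedPartition G β ν p h = ∫⁻ x, ∫⁻ y, ∫⁻ w,
      f (fun a => h (s.toEquiv (.inl a))) x w * f (fun a => h (s.toEquiv (.inr a))) y w
      ∂volume ∂(Measure.pi fun _ : T => ν) ∂(Measure.pi fun _ : T => ν) := by
    intro h
    rw [shiftedPartition_eq_lintegral_halves s β ν hp h]
    refine lintegral_congr fun x => lintegral_congr fun y => ?_
    rw [hgram (fun a => p (x a) + h (s.toEquiv (.inl a)))
      (fun a => p (y a) + h (s.toEquiv (.inr a))), ← lintegral_const_mul]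
    · refine lintegral_congr fun w => ?_
      simp only [f]
      ring
    · exact (hg.comp measurable_prodMk_left).mul (hg.comp measurable_prodMk_left)
  rw [key, key (h ∘ s.foldLeft), key (h ∘ s.foldRight)]
  simp only [Function.comp_apply, s.foldLeft_inl, s.foldLeft_inr, s.foldRight_inl,
    s.foldRight_inr]
  exact lintegral_gram_sq_le _ _ (hf _) (hf _)

end GaussianDomination

open Classical in
/-- Folding along a mirror that separates two vertices with different shifts makes the shift
constant along more edges. -/
lemma MirrorSplitting.adjSum_ne_fold_lt {V T E : Type*} [Fintype V] [Fintype T]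
    {G : SimpleGraph V} (s : MirrorSplitting G T) (h : V → E) {a : T}
    (ha : G.Adj (s.toEquiv (.inl a)) (s.toEquiv (.inr a)))
    (hne : h (s.toEquiv (.inl a)) ≠ h (s.toEquiv (.inr a))) :
    adjSum G (fun x y : E => if x = y then 0 else 1) (h ∘ s.foldLeft) +
      adjSum G (fun x y : E => if x = y then 0 else 1) (h ∘ s.foldRight) <
      2 * adjSum G (fun x y : E => if x = y then (0 : ℕ) else 1) h := by
  have hF : ∀ x y : E, (if x = y then (0 : ℕ) else 1) = if y = x then 0 else 1 := fun x y => by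
    simp only [eq_comm]
  -- With counts `l`, `r` inside the halves and `c > 0` across, the shift `h` has `l + r + 2c`,
  -- while the folds have `2l` and `2r`.
  rw [s.adjSum_eq hF h, s.adjSum_eq hF, s.adjSum_eq hF]
  simp only [Function.comp_apply, s.foldLeft_inl, s.foldLeft_inr, s.foldRight_inl,
    s.foldRight_inr, if_true, ite_self, Finset.sum_const_zero]
  have hpos : 0 < ∑ a, if G.Adj (s.toEquiv (.inl a)) (s.toEquiv (.inr a)) then
      (if h (s.toEquiv (.inl a)) = h (s.toEquiv (.inr a)) then (0 : ℕ) else 1) else 0 := by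
    refine Finset.sum_pos' (fun _ _ => Nat.zero_le _) ⟨a, Finset.mem_univ _, ?_⟩
    rw [if_pos ha, if_neg hne]
    exact one_pos
  simp only [smul_eq_mul]
  omega

/-- Every edge is crossed by a mirror of the graph. -/
def HasMirrors {V : Type*} (G : SimpleGraph V) : Prop :=
  ∀ u v, G.Adj u v → ∃ (T : Type) (_ : Fintype T) (s : MirrorSplitting G T) (a : T),
    (s.toEquiv (.inl a) = u ∧ s.toEquiv (.inr a) = v) ∨
      (s.toEquiv (.inl a) = v ∧ s.toEquiv (.inr a) = u)

/-- Gaussian domination on a graph each of whose edges is crossed by a mirror. -/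
theorem shiftedPartition_le_zero_shift {V X E : Type*} [Fintype V] [MeasurableSpace X]
    [NormedAddCommGroup E] [InnerProductSpace ℝ E] [FiniteDimensional ℝ E] [MeasurableSpace E]
    [BorelSpace E] {G : SimpleGraph V}
    (hG : HasMirrors G) {β : ℝ} (hβ : 0 < β) (ν : Measure X) [IsFiniteMeasure ν] {p : X → E} (hp : Measurable p)
    (h : V → E) : shiftedPartition G β ν p h ≤ shiftedPartition G β ν p 0 := by
  classical
  -- Only shifts `h ∘ φ` compete: the family is finite, so a maximizer exists without compactness,
  -- and it is closed under folding.
  let Z : (V → V) → ENNReal := fun φ => shiftedPartition G β ν p (h ∘ φ)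
  let N : (V → V) → ℕ := fun φ => adjSum G (fun x y : E => if x = y then (0 : ℕ) else 1) (h ∘ φ)
  let A : Finset (V → V) := {φ | ∀ ψ, Z ψ ≤ Z φ}
  have hA : A.Nonempty := by
    obtain ⟨φ, -, hφ⟩ := Finset.exists_max_image Finset.univ Z ⟨id, Finset.mem_univ _⟩
    exact ⟨φ, by simpa [A] using fun ψ => hφ ψ (Finset.mem_univ _)⟩
  obtain ⟨φ, hφA, hmin⟩ := Finset.exists_min_image A N hA
  have hφ : ∀ ψ, Z ψ ≤ Z φ := by simpa [A] using hφA
  refine (hφ id).trans ?_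
  by_cases h0 : Z φ = 0
  · rw [h0]; exact zero_le
  have htop : Z φ ≠ ⊤ := (shiftedPartition_lt_top G hβ ν p _).ne
  refine (shiftedPartition_eq_zero_shift G β ν p fun u v huv => ?_).le
  by_contra hne
  obtain ⟨T, _, s, a, hs⟩ := hG u v huv
  have ha : G.Adj (s.toEquiv (.inl a)) (s.toEquiv (.inr a)) ∧
      (h ∘ φ) (s.toEquiv (.inl a)) ≠ (h ∘ φ) (s.toEquiv (.inr a)) := by
    rcases hs with ⟨h1, h2⟩ | ⟨h1, h2⟩ <;> rw [h1, h2]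
    · exact ⟨huv, hne⟩
    · exact ⟨huv.symm, fun h => hne h.symm⟩
  have hlt := s.adjSum_ne_fold_lt (h ∘ φ) ha.1 ha.2
  have hsq : Z φ * Z φ ≤ Z (φ ∘ s.foldLeft) * Z (φ ∘ s.foldRight) := by
    rw [← sq]
    exact shiftedPartition_sq_le s hβ ν hp (h ∘ φ)
  -- Both folds are maximizers again: neither factor exceeds `Z φ`, and a strict loss in one would
  -- contradict `hsq`, as `Z φ` is nonzero and finite.
  have hl : Z (φ ∘ s.foldLeft) = Z φ := by
    refine le_antisymm (hφ _) (le_of_not_gt fun hlt => ?_)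
    exact absurd (hsq.trans (mul_le_mul_right (hφ _) _))
      (not_le.2 (ENNReal.mul_lt_mul_left h0 htop hlt))
  have hr : Z (φ ∘ s.foldRight) = Z φ := by
    refine le_antisymm (hφ _) (le_of_not_gt fun hlt => ?_)
    exact absurd (hsq.trans (mul_le_mul_left (hφ _) _))
      (not_le.2 (ENNReal.mul_lt_mul_right h0 htop hlt))
  have hlN := hmin (φ ∘ s.foldLeft) (by simpa [A, hl] using hφ)
  have hrN := hmin (φ ∘ s.foldRight) (by simpa [A, hr] using hφ)
  simp only [N, ← Function.comp_assoc] at hlN hrN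
  omega

/-! ### The spin measure and the infrared bound. -/

section SpinModel

variable {V : Type*} [Fintype V] {n : ℕ}

instance isProbabilityMeasure_sphereUniform [NeZero n] : IsProbabilityMeasure (sphereUniform n) where
  measure_univ := by
    have : Nontrivial (EuclideanSpace ℝ (Fin n)) := inferInstance
    rw [sphereUniform, Measure.smul_apply, smul_eq_mul]
    exact ENNReal.inv_mul_cancel
      (Measure.measure_univ_ne_zero.2
        (volume : Measure (EuclideanSpace ℝ (Fin n))).toSphere_ne_zero)
      (measure_ne_top _ _)

instance isOpenPosMeasure_sphereUniform : (sphereUniform n).IsOpenPosMeasure :=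
  Measure.isOpenPosMeasure_smul _ (ENNReal.inv_ne_zero.2 (measure_ne_top _ _))

omit [Fintype V] in
lemma continuous_pairInner (e : Sym2 V) :
    Continuous fun σ : V → SpinSphere n => pairInner σ e := by
  induction e with
  | _ u v =>
    simp only [pairInner, Sym2.lift_mk]
    fun_prop

lemma continuous_edgeInnerSum (G : SimpleGraph V) :
    Continuous (edgeInnerSum G : (V → SpinSphere n) → ℝ) :=
  continuous_finsetSum _ fun e _ => continuous_pairInner e

open Classical in
lemma adjSum_inner_eq (G : SimpleGraph V) (σ : V → SpinSphere n) :
    adjSum G (fun x y : SpinSphere n => inner ℝ (x : EuclideanSpace ℝ (Fin n)) y) σ =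
      2 * edgeInnerSum G σ := by
  unfold adjSum edgeInnerSum
  rw [← Finset.sum_product', Finset.univ_product_univ, ← Finset.sum_filter,
    ← Finset.sum_fiberwise_of_maps_to (t := G.edgeFinset) (g := fun p => s(p.1, p.2))
      (by simp), Finset.mul_sum]
  refine Finset.sum_congr rfl fun e he => ?_
  induction e with
  | _ a b =>
    have hab : G.Adj a b := by simpa using he
    have : ({p ∈ ({p : V × V | G.Adj p.1 p.2} : Finset (V × V)) | s(p.1, p.2) = s(a, b)} :
        Finset (V × V)) = {(a, b), (b, a)} := by
      ext ⟨x, y⟩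
      simp only [Finset.mem_filter, Finset.mem_univ, true_and, Sym2.eq_iff, Finset.mem_insert,
        Finset.mem_singleton, Prod.mk.injEq]
      constructor
      · exact fun h => h.2
      · rintro (⟨rfl, rfl⟩ | ⟨rfl, rfl⟩)
        · exact ⟨hab, by simp⟩
        · exact ⟨hab.symm, by simp⟩
    rw [this, Finset.sum_pair (by simp [hab.ne])]
    simp only [pairInner, Sym2.lift_mk]
    rw [real_inner_comm]
    ring

lemma integrable_of_continuous_spin [NeZero n] {f : (V → SpinSphere n) → ℝ} (hf : Continuous f) :
    Integrable f (Measure.pi fun _ : V => sphereUniform n) :=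
  hf.integrable_of_hasCompactSupport (HasCompactSupport.of_compactSpace f)

instance isProbabilityMeasure_spinMeasure [NeZero n] (G : SimpleGraph V) (β : ℝ) :
    IsProbabilityMeasure (spinMeasure G n β) :=
  isProbabilityMeasure_tilted (integrable_of_continuous_spin
    (((continuous_edgeInnerSum G).const_mul β).rexp))

lemma integrable_spinMeasure [NeZero n] (G : SimpleGraph V) (β : ℝ) {f : (V → SpinSphere n) → ℝ}
    (hf : Continuous f) : Integrable f (spinMeasure G n β) :=
  hf.integrable_of_hasCompactSupport (HasCompactSupport.of_compactSpace f)

lemma spinPartition_pos [NeZero n] (G : SimpleGraph V) (β : ℝ) :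
    0 < ∫ σ, Real.exp (β * edgeInnerSum G σ) ∂(Measure.pi fun _ : V => sphereUniform n) :=
  integral_exp_pos (integrable_of_continuous_spin
    (((continuous_edgeInnerSum G).const_mul β).rexp))

lemma integral_spinMeasure [NeZero n] (G : SimpleGraph V) (β : ℝ) (f : (V → SpinSphere n) → ℝ) :
    ∫ σ, f σ ∂(spinMeasure G n β) =
      (∫ σ, Real.exp (β * edgeInnerSum G σ) * f σ ∂(Measure.pi fun _ : V => sphereUniform n)) /
        ∫ σ, Real.exp (β * edgeInnerSum G σ) ∂(Measure.pi fun _ : V => sphereUniform n) := by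
  rw [spinMeasure, integral_tilted, ← integral_div]
  congr 1
  ext σ
  rw [smul_eq_mul]
  ring

/-- The Dirichlet form over ordered pairs of adjacent vertices. -/
noncomputable def dirichletForm {E : Type*} [NormedAddCommGroup E] [InnerProductSpace ℝ E]
    (G : SimpleGraph V) (τ h : V → E) : ℝ :=
  open Classical in ∑ u, ∑ v, if G.Adj u v then inner ℝ (τ u - τ v) (h u - h v) else 0

section Form

variable {E : Type*} [NormedAddCommGroup E] [InnerProductSpace ℝ E]

lemma dirichletForm_self (G : SimpleGraph V) (h : V → E) :
    dirichletForm G h h = dirichletEnergy G h := by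
  simp only [dirichletForm, dirichletEnergy, adjSum, real_inner_self_eq_norm_sq]

lemma dirichletForm_smul (G : SimpleGraph V) (τ h : V → E) (c : ℝ) :
    dirichletForm G τ (c • h) = c * dirichletForm G τ h := by
  simp only [dirichletForm, Pi.smul_apply, ← smul_sub, inner_smul_right, Finset.mul_sum,
    mul_ite, mul_zero]

lemma dirichletEnergy_smul (G : SimpleGraph V) (h : V → E) (c : ℝ) :
    dirichletEnergy G (c • h) = c ^ 2 * dirichletEnergy G h := by
  simp only [dirichletEnergy, adjSum, Pi.smul_apply, ← smul_sub, norm_smul, mul_pow,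
    Finset.mul_sum, mul_ite, mul_zero, Real.norm_eq_abs, sq_abs]

lemma dirichletEnergy_add (G : SimpleGraph V) (τ h : V → E) :
    dirichletEnergy G (τ + h) =
      dirichletEnergy G τ + 2 * dirichletForm G τ h + dirichletEnergy G h := by
  simp only [dirichletEnergy, dirichletForm, adjSum, Finset.mul_sum, ← Finset.sum_add_distrib,
    mul_ite, mul_zero]
  refine Finset.sum_congr rfl fun u _ => Finset.sum_congr rfl fun v _ => ?_
  split_ifs
  · rw [Pi.add_apply, Pi.add_apply, add_sub_add_comm, norm_add_sq_real]
  · simp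

open Classical in
/-- Summation by parts. -/
lemma dirichletForm_eq_sum_inner (G : SimpleGraph V) (τ h : V → E) :
    dirichletForm G τ h =
      2 * ∑ u, inner ℝ (τ u) (∑ v, if G.Adj u v then h u - h v else 0) := by
  have h1 : ∑ u, ∑ v, (if G.Adj u v then inner ℝ (τ v) (h u - h v) else 0) =
      -∑ u, ∑ v, (if G.Adj u v then inner ℝ (τ u) (h u - h v) else 0) := by
    rw [Finset.sum_comm, ← Finset.sum_neg_distrib]
    refine Finset.sum_congr rfl fun u _ => ?_
    rw [← Finset.sum_neg_distrib]
    refine Finset.sum_congr rfl fun v _ => ?_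
    rw [G.adj_comm]
    split_ifs
    · rw [← inner_neg_right, neg_sub]
    · simp
  have h2 : dirichletForm G τ h = ∑ u, ∑ v, (if G.Adj u v then inner ℝ (τ u) (h u - h v) else 0) -
      ∑ u, ∑ v, (if G.Adj u v then inner ℝ (τ v) (h u - h v) else 0) := by
    simp only [dirichletForm, ← Finset.sum_sub_distrib]
    refine Finset.sum_congr rfl fun u _ => Finset.sum_congr rfl fun v _ => ?_
    split_ifs
    · rw [inner_sub_left]
    · simp
  rw [h2, h1, sub_neg_eq_add, ← two_mul]
  congr 1
  refine Finset.sum_congr rfl fun u _ => ?_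
  rw [inner_sum]
  refine Finset.sum_congr rfl fun v _ => ?_
  split_ifs <;> simp

lemma continuous_dirichletForm (G : SimpleGraph V) (h : V → E) :
    Continuous fun τ : V → E => dirichletForm G τ h := by
  unfold dirichletForm
  refine continuous_finsetSum _ fun u _ => continuous_finsetSum _ fun v _ => ?_
  split_ifs <;> fun_prop

end Form

/-- For unit vectors `‖x - y‖² = 2 - 2 ⟨x, y⟩`, so the Gibbs weight is the Gaussian weight up to a
constant factor. -/
lemma exists_dirichletEnergy_spin (G : SimpleGraph V) :
    ∃ C : ℝ, ∀ σ : V → SpinSphere n,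
      dirichletEnergy G (fun v => (σ v : EuclideanSpace ℝ (Fin n))) = C - 4 * edgeInnerSum G σ := by
  classical
  refine ⟨∑ u, ∑ v, if G.Adj u v then 2 else 0, fun σ => ?_⟩
  have h := adjSum_inner_eq G σ
  have : dirichletEnergy G (fun v => (σ v : EuclideanSpace ℝ (Fin n))) =
      (∑ u, ∑ v, if G.Adj u v then 2 else 0) - 2 *
        adjSum G (fun x y : SpinSphere n => inner ℝ (x : EuclideanSpace ℝ (Fin n)) y) σ := by
    simp only [dirichletEnergy, adjSum, Finset.mul_sum, ← Finset.sum_sub_distrib]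
    refine Finset.sum_congr rfl fun u _ => Finset.sum_congr rfl fun v _ => ?_
    split_ifs
    · rw [norm_sub_sq_real, norm_eq_of_mem_sphere, norm_eq_of_mem_sphere]
      ring
    · simp
  rw [this, h]
  ring

/-- This is `Z(h) / Z(0) ≤ 1` with the energy of `σ + h` expanded: the term quadratic in `h` does
not depend on `σ` and moves to the right. -/
lemma integral_exp_dirichletForm_le [NeZero n] {G : SimpleGraph V} (hG : HasMirrors G) {β : ℝ}
    (hβ : 0 < β) (h : V → EuclideanSpace ℝ (Fin n)) :
    ∫ σ, Real.exp (-(β / 2) * dirichletForm G (fun v => (σ v : EuclideanSpace ℝ (Fin n))) h)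
      ∂(spinMeasure G n β) ≤ Real.exp (β / 4 * dirichletEnergy G h) := by
  obtain ⟨C, hC⟩ := exists_dirichletEnergy_spin (n := n) G
  have hGD := shiftedPartition_le_zero_shift hG hβ (sphereUniform n)
    (p := fun x : SpinSphere n => (x : EuclideanSpace ℝ (Fin n))) measurable_subtype_coe h
  have hcont : ∀ k : V → EuclideanSpace ℝ (Fin n), Continuous fun σ : V → SpinSphere n =>
      Real.exp (-(β / 4) * dirichletEnergy G fun v => (σ v : EuclideanSpace ℝ (Fin n)) + k v) := by
    intro k
    have : Continuous fun (σ : V → SpinSphere n) v =>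
      (σ v : EuclideanSpace ℝ (Fin n)) + k v := by fun_prop
    exact (((continuous_dirichletEnergy G).comp this).const_mul _).rexp
  have hZ : ∀ k : V → EuclideanSpace ℝ (Fin n), shiftedPartition G β (sphereUniform n)
      (fun x : SpinSphere n => (x : EuclideanSpace ℝ (Fin n))) k =
      ENNReal.ofReal (∫ σ, Real.exp (-(β / 4) * dirichletEnergy G
        fun v => (σ v : EuclideanSpace ℝ (Fin n)) + k v)
        ∂(Measure.pi fun _ : V => sphereUniform n)) := fun k =>
    (ofReal_integral_eq_lintegral_ofReal (integrable_of_continuous_spin (hcont k))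
      (Eventually.of_forall fun _ => by positivity)).symm
  rw [hZ, hZ, ENNReal.ofReal_le_ofReal_iff (integral_nonneg fun _ => by positivity)] at hGD
  have e1 : ∀ σ : V → SpinSphere n, Real.exp (-(β / 4) * dirichletEnergy G
      fun v => (σ v : EuclideanSpace ℝ (Fin n)) + h v) =
      (Real.exp (-(β / 4) * C) * Real.exp (-(β / 4 * dirichletEnergy G h))) *
      (Real.exp (β * edgeInnerSum G σ) * Real.exp (-(β / 2) *
        dirichletForm G (fun v => (σ v : EuclideanSpace ℝ (Fin n))) h)) := by
    intro σ
    have := dirichletEnergy_add G (fun v => (σ v : EuclideanSpace ℝ (Fin n))) h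
    rw [hC] at this
    change dirichletEnergy G (fun v => (σ v : EuclideanSpace ℝ (Fin n)) + h v) = _ at this
    rw [this]
    simp only [← Real.exp_add]
    congr 1
    ring
  have e2 : ∀ σ : V → SpinSphere n, Real.exp (-(β / 4) * dirichletEnergy G
      fun v => (σ v : EuclideanSpace ℝ (Fin n)) + (0 : V → EuclideanSpace ℝ (Fin n)) v) =
      Real.exp (-(β / 4) * C) * Real.exp (β * edgeInnerSum G σ) := by
    intro σ
    simp only [Pi.zero_apply, add_zero]
    rw [hC, ← Real.exp_add]
    congr 1
    ring
  simp_rw [e1, e2] at hGD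
  rw [integral_const_mul, integral_const_mul, mul_assoc,
    mul_le_mul_iff_right₀ (Real.exp_pos _), Real.exp_neg, inv_mul_le_iff₀ (Real.exp_pos _)] at hGD
  rw [integral_spinMeasure, div_le_iff₀ (spinPartition_pos G β)]
  exact hGD

lemma le_of_forall_one_add_mul_le_exp {a b : ℝ} (h : ∀ t : ℝ, 0 < t → 1 + a * t ≤ Real.exp (b * t)) :
    a ≤ b := by
  have hd : HasDerivAt (fun t : ℝ => Real.exp (b * t)) b 0 := by
    simpa using ((hasDerivAt_id (0 : ℝ)).const_mul b).exp
  have ht := hd.tendsto_slope_zero_right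
  refine ge_of_tendsto ht ?_
  filter_upwards [self_mem_nhdsWithin] with t ht
  have ht0 : 0 < t := ht
  have := h t ht0
  simp only [zero_add, mul_zero, Real.exp_zero, smul_eq_mul]
  rw [inv_mul_eq_div, le_div_iff₀ ht0]
  linarith

lemma one_add_sq_div_two_le_cosh (y : ℝ) : 1 + y ^ 2 / 2 ≤ Real.cosh y := by
  have h1 : Real.cosh y = 1 + 2 * Real.sinh (y / 2) ^ 2 := by
    rw [show y = 2 * (y / 2) by ring, Real.cosh_two_mul, Real.cosh_sq]
    ring_nf
  have h2 : (y / 2) ^ 2 ≤ Real.sinh (y / 2) ^ 2 := by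
    rw [sq_le_sq, Real.abs_sinh]
    exact Real.self_le_sinh_iff.2 (abs_nonneg _)
  rw [h1]
  linarith

/-- The infrared bound in quadratic form. -/
lemma integral_dirichletForm_sq_le [NeZero n] {G : SimpleGraph V} (hG : HasMirrors G) {β : ℝ}
    (hβ : 0 < β) (h : V → EuclideanSpace ℝ (Fin n)) :
    β * ∫ σ, dirichletForm G (fun v => (σ v : EuclideanSpace ℝ (Fin n))) h ^ 2
      ∂(spinMeasure G n β) ≤ 2 * dirichletEnergy G h := by
  have hB : Continuous fun σ : V → SpinSphere n =>
      dirichletForm G (fun v => (σ v : EuclideanSpace ℝ (Fin n))) h :=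
    (continuous_dirichletForm G h).comp (by fun_prop)
  suffices β ^ 2 / 8 * ∫ σ, dirichletForm G (fun v => (σ v : EuclideanSpace ℝ (Fin n))) h ^ 2
      ∂(spinMeasure G n β) ≤ β / 4 * dirichletEnergy G h by
    refine le_of_mul_le_mul_left ?_ (show 0 < β / 8 by positivity)
    linarith
  refine le_of_forall_one_add_mul_le_exp fun t ht => ?_
  -- Averaging over `±√t • h` produces a hyperbolic cosine, and `cosh y ≥ 1 + y² / 2`. The scale
  -- `√t` makes the second-order terms linear in `t`, so slopes at `0` can be compared.
  have hp := integral_exp_dirichletForm_le hG hβ (√t • h)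
  have hm := integral_exp_dirichletForm_le hG hβ (-√t • h)
  simp only [dirichletForm_smul, dirichletEnergy_smul, neg_sq, Real.sq_sqrt ht.le] at hp hm
  have hint : ∀ c : ℝ, Integrable (fun σ : V → SpinSphere n => Real.exp (-(β / 2) *
      (c * dirichletForm G (fun v => (σ v : EuclideanSpace ℝ (Fin n))) h)))
      (spinMeasure G n β) := fun c =>
    integrable_spinMeasure _ _ (((hB.const_mul c).const_mul _).rexp)
  have hle : ∫ σ, (1 + β ^ 2 / 8 * t *
      dirichletForm G (fun v => (σ v : EuclideanSpace ℝ (Fin n))) h ^ 2) ∂(spinMeasure G n β) ≤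
      ∫ σ, (1 / 2 * (Real.exp (-(β / 2) *
        (√t * dirichletForm G (fun v => (σ v : EuclideanSpace ℝ (Fin n))) h)) +
        Real.exp (-(β / 2) * (-√t *
        dirichletForm G (fun v => (σ v : EuclideanSpace ℝ (Fin n))) h)))) ∂(spinMeasure G n β) := by
    refine integral_mono (integrable_spinMeasure _ _ (by fun_prop))
      (((hint _).add (hint _)).const_mul _) fun σ => ?_
    have := one_add_sq_div_two_le_cosh
      (β / 2 * (√t * dirichletForm G (fun v => (σ v : EuclideanSpace ℝ (Fin n))) h))
    rw [Real.cosh_eq, mul_pow, mul_pow, Real.sq_sqrt ht.le] at this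
    have e1 : -(β / 2) * (-√t * dirichletForm G (fun v => (σ v : EuclideanSpace ℝ (Fin n))) h) =
      β / 2 * (√t * dirichletForm G (fun v => (σ v : EuclideanSpace ℝ (Fin n))) h) := by ring
    beta_reduce
    rw [e1, neg_mul]
    nlinarith
  rw [integral_const_mul, integral_add (hint _) (hint _),
    integral_add (integrable_const _) (integrable_spinMeasure _ _ (by fun_prop)),
    integral_const_mul] at hle
  simp only [integral_const, probReal_univ, smul_eq_mul, mul_one] at hle
  have e3 : β / 4 * dirichletEnergy G h * t = β / 4 * (t * dirichletEnergy G h) := by ring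
  rw [e3]
  linarith

open Classical in
/-- The infrared bound for an eigenfunction of the graph Laplacian. -/
lemma integral_sum_inner_sq_le [NeZero n] {G : SimpleGraph V} (hG : HasMirrors G) {β : ℝ}
    (hβ : 0 < β) {h : V → EuclideanSpace ℝ (Fin n)} {l : ℝ} (hl : 0 < l)
    (heig : ∀ u, (∑ v, if G.Adj u v then h u - h v else 0) = (2 * l) • h u) :
    ∫ σ, (∑ u, inner ℝ (σ u : EuclideanSpace ℝ (Fin n)) (h u)) ^ 2 ∂(spinMeasure G n β) ≤
      (∑ u, ‖h u‖ ^ 2) / (2 * β * l) := by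
  -- With `S` the sum to be bounded, the quadratic bound now reads `β (4l)² E[S²] ≤ 8l ∑ ‖h u‖²`; a
  -- factor `8l` cancels.
  have hform : ∀ τ : V → EuclideanSpace ℝ (Fin n),
      dirichletForm G τ h = 4 * l * ∑ u, inner ℝ (τ u) (h u) := by
    intro τ
    rw [dirichletForm_eq_sum_inner]
    simp only [heig, inner_smul_right, ← Finset.mul_sum]
    ring
  have hq := integral_dirichletForm_sq_le hG hβ h
  rw [← dirichletForm_self] at hq
  simp only [hform, mul_pow, integral_const_mul, real_inner_self_eq_norm_sq] at hq
  rw [le_div_iff₀ (by positivity)]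
  refine le_of_mul_le_mul_left ?_ (show 0 < 8 * l by positivity)
  linarith

end SpinModel

/-! ### Mirrors and Fourier modes of the torus. -/

open Classical in
/-- A mirror splitting from an involutive automorphism. -/
noncomputable def MirrorSplitting.ofInvolutive {V : Type*} {G : SimpleGraph V} {θ : V → V}
    (hθ : Function.Involutive θ) {P : V → Prop} (hP : ∀ v, P (θ v) ↔ ¬P v)
    (hadj : ∀ u v, G.Adj (θ u) (θ v) ↔ G.Adj u v)
    (hcross : ∀ u v, P u → ¬P v → G.Adj u v → v = θ u) : MirrorSplitting G {v // P v} where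
  toEquiv :=
    { toFun := Sum.elim (fun a => a.1) (fun a => θ a.1)
      invFun := fun v => if h : P v then .inl ⟨v, h⟩ else .inr ⟨θ v, (hP v).2 h⟩
      left_inv := by
        rintro (⟨a, ha⟩ | ⟨a, ha⟩)
        · simp [ha]
        · have : ¬P (θ a) := fun h => (hP a).1 h ha
          simp [this, hθ a]
      right_inv := by
        intro v
        by_cases h : P v
        · simp [h]
        · simp [h, hθ v] }
  adj_inr_inr := fun a b => hadj a b
  eq_of_adj := by
    rintro ⟨a, ha⟩ ⟨b, hb⟩ h
    have h1 : ¬P (θ b) := fun h => (hP b).1 h hb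
    have h2 : θ b = θ a := hcross a (θ b) ha h1 h
    exact Subtype.ext (hθ.injective h2).symm

section Torus

variable {d L : ℕ} [NeZero L]

lemma val_neg_one_add (y : ZMod (2 * L)) : (-(1 + y)).val = 2 * L - 1 - y.val := by
  have hy := ZMod.val_lt y
  have h : -(1 + y) = ((2 * L - 1 - y.val : ℕ) : ZMod (2 * L)) := by
    rw [neg_eq_iff_add_eq_zero]
    nth_rewrite 1 [← ZMod.natCast_zmod_val y]
    rw [← Nat.cast_one, ← Nat.cast_add, ← Nat.cast_add,
      show 1 + y.val + (2 * L - 1 - y.val) = 2 * L by omega, ZMod.natCast_self]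
  rw [h, ZMod.val_natCast_of_lt (by omega)]

/-- The half `0, …, L-1` is left only through the edges `{L-1, L}` and `{0, 2L-1}`; on both the
representatives sum to `2L - 1`. -/
lemma add_add_one_eq_zero_of_cross {y z : ZMod (2 * L)} (hy : y.val < L) (hz : ¬z.val < L)
    (h : y - z = 1 ∨ z - y = 1) : z + y + 1 = 0 := by
  have hL : 0 < L := Nat.pos_of_ne_zero (NeZero.ne L)
  have hz' := ZMod.val_lt z
  have hsum : z.val + y.val + 1 = 2 * L := by
    rcases h with h | h
    · rw [sub_eq_iff_eq_add'] at h
      have : y.val = (z.val + 1) % (2 * L) := by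
        rw [← ZMod.val_natCast, Nat.cast_add, ZMod.natCast_zmod_val, Nat.cast_one, h]
      by_cases hlt : z.val + 1 < 2 * L
      · rw [Nat.mod_eq_of_lt hlt] at this
        omega
      · rw [show z.val + 1 = 2 * L by omega, Nat.mod_self] at this
        omega
    · rw [sub_eq_iff_eq_add'] at h
      have : z.val = (y.val + 1) % (2 * L) := by
        rw [← ZMod.val_natCast, Nat.cast_add, ZMod.natCast_zmod_val, Nat.cast_one, h]
      rw [Nat.mod_eq_of_lt (by omega)] at this
      omega
  have := congrArg (Nat.cast : ℕ → ZMod (2 * L)) hsum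
  rw [ZMod.natCast_self] at this
  simpa using this

/-- The edge from `c` to `c + 1` in direction `j` is crossed by the mirror `x_j ↦ 2c + 1 - x_j`,
whose half is `c + 1, …, c + L`. As the side `2L` is even, no vertex is fixed. -/
lemma hasMirrors_torusGraph : HasMirrors (torusGraph d L) := by
  have main : ∀ (u v : Fin d → ZMod (2 * L)) (j : Fin d), u j - v j = 1 →
      (∀ i, i ≠ j → u i = v i) → ∃ (T : Type) (_ : Fintype T)
      (s : MirrorSplitting (torusGraph d L) T) (a : T),
      s.toEquiv (.inl a) = u ∧ s.toEquiv (.inr a) = v := by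
    classical
    intro u v j hj huv
    let c := v j
    let θ : (Fin d → ZMod (2 * L)) → (Fin d → ZMod (2 * L)) := fun x =>
      Function.update x j (2 * c + 1 - x j)
    let P : (Fin d → ZMod (2 * L)) → Prop := fun x => (x j - c - 1).val < L
    have hθj : ∀ x, θ x j = 2 * c + 1 - x j := fun x => by simp [θ]
    have hθi : ∀ x i, i ≠ j → θ x i = x i := fun x i hi => by simp [θ, hi]
    have hθ : Function.Involutive θ := by
      intro x
      ext i
      by_cases hi : i = j
      · subst hi
        rw [hθj, hθj]
        ring
      · rw [hθi _ _ hi, hθi _ _ hi]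
    have hP : ∀ x, P (θ x) ↔ ¬P x := by
      intro x
      have e : θ x j - c - 1 = -(1 + (x j - c - 1)) := by
        rw [hθj]
        ring
      simp only [P, e, val_neg_one_add]
      have := ZMod.val_lt (x j - c - 1)
      omega
    have hadj' : ∀ x y, (torusGraph d L).Adj x y → (torusGraph d L).Adj (θ x) (θ y) := by
      rintro x y ⟨i, hi, hxy⟩
      refine ⟨i, ?_, fun k hk => ?_⟩
      · by_cases hij : i = j
        · subst hij
          rw [hθj, hθj]
          rcases hi with hi | hi
          · right; rw [← hi]; ring
          · left; rw [← hi]; ring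
        · rwa [hθi _ _ hij, hθi _ _ hij]
      · by_cases hkj : k = j
        · subst hkj
          rw [hθj, hθj, hxy k hk]
        · rw [hθi _ _ hkj, hθi _ _ hkj, hxy k hk]
    have hadj : ∀ x y, (torusGraph d L).Adj (θ x) (θ y) ↔ (torusGraph d L).Adj x y :=
      fun x y => ⟨fun h => by simpa [hθ x, hθ y] using hadj' _ _ h, hadj' x y⟩
    have hcross : ∀ x y, P x → ¬P y → (torusGraph d L).Adj x y → y = θ x := by
      rintro x y hx hy ⟨i, hi, hxy⟩
      by_cases hij : i = j
      · subst hij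
        have h0 := add_add_one_eq_zero_of_cross hx hy (by
          rcases hi with hi | hi
          · left; rw [← hi]; ring
          · right; rw [← hi]; ring)
        ext k
        by_cases hk : k = i
        · subst hk
          rw [hθj]
          linear_combination h0
        · rw [hθi _ _ hk, hxy k hk]
      · exfalso
        apply hy
        simp only [P] at hx ⊢
        rwa [← hxy j (Ne.symm hij)]
    have hu : P u := by
      have : u j - c - 1 = 0 := by rw [← hj]; ring
      simp only [P, this, ZMod.val_zero]
      exact Nat.pos_of_ne_zero (NeZero.ne L)
    refine ⟨{x // P x}, inferInstance, MirrorSplitting.ofInvolutive hθ hP hadj hcross, ⟨u, hu⟩,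
      rfl, ?_⟩
    change θ u = v
    ext i
    by_cases hi : i = j
    · subst hi
      rw [hθj]
      linear_combination -hj
    · rw [hθi _ _ hi, huv i hi]
  rintro u v ⟨j, hj | hj, huv⟩
  · obtain ⟨T, hT, s, a, h⟩ := main u v j hj huv
    exact ⟨T, hT, s, a, .inl h⟩
  · obtain ⟨T, hT, s, a, h⟩ := main v u j hj fun i hi => (huv i hi).symm
    exact ⟨T, hT, s, a, .inr h⟩

-- For `L = 1` the two neighbours in each direction coincide and would be counted twice; hence `2 ≤
-- L`.
open Classical in
lemma sum_torusGraph_adj (hL : 2 ≤ L) {M : Type*} [AddCommMonoid M]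
    (u : Fin d → ZMod (2 * L)) (F : (Fin d → ZMod (2 * L)) → M) :
    (∑ v, if (torusGraph d L).Adj u v then F v else 0) =
      ∑ j, (F (u + Pi.single j 1) + F (u + Pi.single j (-1))) := by
  have : Fact (2 < 2 * L) := ⟨by omega⟩
  have : Nontrivial (ZMod (2 * L)) := ZMod.nontrivial_iff.2 (by omega)
  have hne : (1 : ZMod (2 * L)) ≠ -1 := (ZMod.neg_one_ne_one).symm
  let g : Fin d × Bool → (Fin d → ZMod (2 * L)) := fun p =>
    u + Pi.single p.1 (if p.2 then 1 else -1)
  have hb : ∀ b : Bool, (if b then (1 : ZMod (2 * L)) else -1) ≠ 0 := by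
    intro b; cases b <;> simp
  have hg : Function.Injective g := by
    rintro ⟨i, b⟩ ⟨j, c⟩ h
    have h' := add_left_cancel h
    have hi := congrFun h' i
    simp only [Pi.single_eq_same] at hi
    have hij : i = j := by
      by_contra hij
      rw [Pi.single_eq_of_ne hij] at hi
      exact hb b hi
    subst hij
    rw [Pi.single_eq_same] at hi
    cases b <;> cases c <;> simp_all [eq_comm]
  have himg : (Finset.univ.filter fun v => (torusGraph d L).Adj u v) = Finset.univ.image g := by
    ext v
    simp only [Finset.mem_filter, Finset.mem_univ, true_and, Finset.mem_image, Prod.exists, g]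
    constructor
    · rintro ⟨j, h, huv⟩
      have key : ∀ b : Bool, v j = u j + (if b then 1 else -1) →
          u + Pi.single j (if b then 1 else -1) = v := by
        intro b hb
        ext i
        by_cases hi : i = j
        · subst hi; simp [hb]
        · simp [hi, huv i hi]
      rcases h with h | h
      · exact ⟨j, false, key _ (by simp only [Bool.false_eq_true, if_false]; rw [← h]; ring)⟩
      · exact ⟨j, true, key _ (by simp only [if_true]; rw [← h]; ring)⟩
    · rintro ⟨j, b, rfl⟩
      refine ⟨j, ?_, fun i hi => by simp [hi]⟩
      cases b <;> simp
  rw [← Finset.sum_filter, himg, Finset.sum_image fun _ _ _ _ h => hg h, Fintype.sum_prod_type]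
  simp [g]

/-- The eigenvalue `∑ j, (1 - cos (π k_j / L))` of (half) the torus Laplacian. -/
noncomputable def torusEigenvalue (k : Fin d → ZMod (2 * L)) : ℝ :=
  ∑ j, (1 - (ZMod.stdAddChar (k j)).re)

lemma re_stdAddChar_eq_cos (κ : ZMod (2 * L)) :
    (ZMod.stdAddChar κ).re = Real.cos (Real.pi * (κ.val / L)) := by
  have hL : (L : ℂ) ≠ 0 := by exact_mod_cast NeZero.ne L
  conv_lhs => rw [← ZMod.natCast_zmod_val κ]
  rw [← Int.cast_natCast, ZMod.stdAddChar_coe,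
    show 2 * (Real.pi : ℂ) * Complex.I * ((κ.val : ℤ) : ℂ) / ((2 * L : ℕ) : ℂ) =
      ((Real.pi * (κ.val / L) : ℝ) : ℂ) * Complex.I by push_cast; field_simp]
  rw [Complex.exp_ofReal_mul_I_re]

lemma torusEigenvalue_eq (k : Fin d → ZMod (2 * L)) :
    torusEigenvalue k = ∑ j, (1 - Real.cos (Real.pi * ((k j).val / L))) := by
  simp only [torusEigenvalue, re_stdAddChar_eq_cos]

lemma torusEigenvalue_pos {k : Fin d → ZMod (2 * L)} (hk : k ≠ 0) : 0 < torusEigenvalue k := by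
  obtain ⟨j, hj⟩ := Function.ne_iff.1 hk
  rw [torusEigenvalue_eq]
  refine Finset.sum_pos' (fun i _ => sub_nonneg.2 (Real.cos_le_one _)) ⟨j, Finset.mem_univ _, ?_⟩
  have hL : (0 : ℝ) < L := by exact_mod_cast Nat.pos_of_ne_zero (NeZero.ne L)
  have h1 : 0 < (k j).val := Nat.pos_of_ne_zero ((ZMod.val_ne_zero _).2 hj)
  have h2 : ((k j).val : ℝ) < 2 * L := by exact_mod_cast ZMod.val_lt (k j)
  have h3 : (k j).val / (L : ℝ) < 2 := by rwa [div_lt_iff₀ hL]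
  have h4 : 0 < (k j).val / (L : ℝ) := by positivity
  have hpi := Real.pi_pos
  rw [sub_pos]
  refine lt_of_le_of_ne (Real.cos_le_one _) fun h => ?_
  have := (Real.cos_eq_one_iff_of_lt_of_lt (by nlinarith) (by nlinarith)).1 h
  nlinarith [mul_pos hpi h4]

/-- The character `x ↦ exp (i π ⟨k, x⟩ / L)` of the torus. -/
noncomputable def torusChar (k x : Fin d → ZMod (2 * L)) : ℂ := ZMod.stdAddChar (k ⬝ᵥ x)

lemma torusChar_add (k x y : Fin d → ZMod (2 * L)) :
    torusChar k (x + y) = torusChar k x * torusChar k y := by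
  rw [torusChar, dotProduct_add, AddChar.map_add_eq_mul]; rfl

lemma torusChar_single (k : Fin d → ZMod (2 * L)) (j : Fin d) (c : ZMod (2 * L)) :
    torusChar k (Pi.single j c) = ZMod.stdAddChar (k j * c) := by
  rw [torusChar, dotProduct_single]

lemma norm_torusChar (k x : Fin d → ZMod (2 * L)) : ‖torusChar k x‖ = 1 :=
  AddChar.norm_apply _ _

lemma torusChar_neg (k x : Fin d → ZMod (2 * L)) :
    torusChar k (-x) = (starRingEnd ℂ) (torusChar k x) := by
  rw [torusChar, dotProduct_neg, AddChar.map_neg_eq_conj]; rfl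

lemma sum_torusChar (z : Fin d → ZMod (2 * L)) :
    ∑ k, torusChar k z = if z = 0 then ((2 * L : ℕ) : ℂ) ^ d else 0 := by
  classical
  have h1 : ∀ k : Fin d → ZMod (2 * L), torusChar k z = ∏ j, ZMod.stdAddChar (k j * z j) := by
    intro k
    exact map_prod (ZMod.stdAddChar (N := 2 * L)).toMonoidHom
      (fun j => Multiplicative.ofAdd (k j * z j)) Finset.univ
  simp_rw [h1]
  rw [← Fintype.prod_sum (f := fun j (κ : ZMod (2 * L)) => ZMod.stdAddChar (κ * z j))]
  simp_rw [AddChar.sum_mulShift _ (ZMod.isPrimitive_stdAddChar (2 * L)), ZMod.card]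
  split_ifs with hz
  · subst hz
    simp
  · obtain ⟨j, hj⟩ := Function.ne_iff.1 hz
    exact Finset.prod_eq_zero (Finset.mem_univ j) (by rw [if_neg (by simpa using hj)]; simp)

-- A step `±e_j` multiplies the character by conjugate phases, whose sum is twice a real part.
open Classical in
lemma laplacian_torusChar (hL : 2 ≤ L) (k u : Fin d → ZMod (2 * L)) :
    (∑ v, if (torusGraph d L).Adj u v then torusChar k u - torusChar k v else 0) =
      ((2 * torusEigenvalue k : ℝ) : ℂ) * torusChar k u := by
  rw [sum_torusGraph_adj hL u (fun v => torusChar k u - torusChar k v), torusEigenvalue,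
    Finset.mul_sum, Complex.ofReal_sum, Finset.sum_mul]
  refine Finset.sum_congr rfl fun j _ => ?_
  rw [torusChar_add, torusChar_add, torusChar_single, torusChar_single, mul_one, mul_neg_one,
    AddChar.map_neg_eq_conj]
  have := Complex.add_conj (ZMod.stdAddChar (k j))
  push_cast at this ⊢
  linear_combination -torusChar k u * this

end Torus

/-! ### Quadratic forms in the spins and positivity. -/

section StructureFactor

variable {V : Type*} [Fintype V] {n : ℕ}

lemma sum_sum_mul_inner_eq (f : V → ℝ) (σ : V → SpinSphere n) :
    ∑ i, (∑ u, inner ℝ (σ u : EuclideanSpace ℝ (Fin n)) (EuclideanSpace.single i (f u))) ^ 2 =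
      ∑ u, ∑ v, f u * f v * inner ℝ (σ u : EuclideanSpace ℝ (Fin n)) (σ v) := by
  have h1 : ∀ i, (∑ u, inner ℝ (σ u : EuclideanSpace ℝ (Fin n)) (EuclideanSpace.single i (f u))) =
      ∑ u, f u * (σ u : EuclideanSpace ℝ (Fin n)) i := fun i => by
    simp [EuclideanSpace.inner_single_right]
  simp_rw [h1, sq, Finset.sum_mul_sum]
  rw [Finset.sum_comm]
  refine Finset.sum_congr rfl fun u _ => ?_
  rw [Finset.sum_comm]
  refine Finset.sum_congr rfl fun v _ => ?_
  rw [PiLp.inner_apply, Finset.mul_sum]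
  refine Finset.sum_congr rfl fun i _ => ?_
  simp
  ring

open Classical in
/-- The infrared bound for a scalar eigenfunction, summed over the spin components. -/
lemma integral_quadratic_le [NeZero n] {G : SimpleGraph V} (hG : HasMirrors G) {β : ℝ}
    (hβ : 0 < β) {f : V → ℝ} {l : ℝ} (hl : 0 < l)
    (heig : ∀ u, (∑ v, if G.Adj u v then f u - f v else 0) = 2 * l * f u) :
    ∫ σ, (∑ u, ∑ v, f u * f v * inner ℝ (σ u : EuclideanSpace ℝ (Fin n)) (σ v))
      ∂(spinMeasure G n β) ≤ n * (∑ u, f u ^ 2) / (2 * β * l) := by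
  simp_rw [← sum_sum_mul_inner_eq]
  rw [integral_finsetSum _ fun i _ => integrable_spinMeasure _ _ (by fun_prop)]
  calc _ ≤ ∑ i : Fin n, (∑ u, f u ^ 2) / (2 * β * l) := by
        refine Finset.sum_le_sum fun i _ => ?_
        have h := integral_sum_inner_sq_le (n := n) hG hβ
          (h := fun u => EuclideanSpace.single i (f u)) hl fun u => by
          ext j
          by_cases hj : j = i
          · subst hj
            have h2 := heig u
            simp only [WithLp.ofLp_sum, Finset.sum_apply, PiLp.smul_apply, smul_eq_mul,
              PiLp.single_apply, if_true]
            rw [← h2]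
            refine Finset.sum_congr rfl fun v _ => ?_
            split_ifs <;> simp
          · simp only [WithLp.ofLp_sum, Finset.sum_apply, PiLp.smul_apply, smul_eq_mul,
              PiLp.single_apply, if_neg hj, mul_zero]
            refine Finset.sum_eq_zero fun v _ => ?_
            split_ifs <;> simp [hj]
        simpa using h
    _ = _ := by
      rw [Finset.sum_const, Finset.card_univ, Fintype.card_fin, nsmul_eq_mul, mul_div_assoc]

lemma card_sq_mul_averagedCorrelation [Nonempty V] [NeZero n] (G : SimpleGraph V) (β : ℝ) :
    (Fintype.card V : ℝ) ^ 2 * averagedCorrelation G n β =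
      ∫ σ, (∑ u, ∑ v, inner ℝ (σ u : EuclideanSpace ℝ (Fin n)) (σ v)) ∂(spinMeasure G n β) := by
  have hV : (Fintype.card V : ℝ) ≠ 0 := by exact_mod_cast Fintype.card_ne_zero
  rw [averagedCorrelation, mul_inv_cancel_left₀ (by positivity),
    integral_finsetSum _ fun i _ => integrable_spinMeasure _ _ (by fun_prop)]
  refine Finset.sum_congr rfl fun u _ => ?_
  rw [integral_finsetSum _ fun i _ => integrable_spinMeasure _ _ (by fun_prop)]
  rfl

/-- The double sum is `‖∑ σ_u‖²`, continuous, nonnegative and nonzero at the aligned configuration,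
and the reference measure charges every nonempty open set. -/
lemma averagedCorrelation_pos [Nonempty V] [NeZero n] (G : SimpleGraph V) (β : ℝ) :
    0 < averagedCorrelation G n β := by
  have hV : (0 : ℝ) < Fintype.card V := by exact_mod_cast Fintype.card_pos
  refine pos_of_mul_pos_right (b := _) (a := (Fintype.card V : ℝ) ^ 2) ?_ (by positivity)
  rw [card_sq_mul_averagedCorrelation, integral_spinMeasure]
  refine div_pos ?_ (spinPartition_pos G β)
  have hsq : ∀ σ : V → SpinSphere n, ∑ u, ∑ v, inner ℝ (σ u : EuclideanSpace ℝ (Fin n)) (σ v) =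
      ‖∑ u, (σ u : EuclideanSpace ℝ (Fin n))‖ ^ 2 := by
    intro σ
    rw [← real_inner_self_eq_norm_sq, sum_inner]
    simp_rw [inner_sum]
  simp_rw [hsq]
  have hx : (EuclideanSpace.single (0 : Fin n) (1 : ℝ)) ∈
      Metric.sphere (0 : EuclideanSpace ℝ (Fin n)) 1 := by simp
  have hcont : Continuous fun σ : V → SpinSphere n => Real.exp (β * edgeInnerSum G σ) *
      ‖∑ u, (σ u : EuclideanSpace ℝ (Fin n))‖ ^ 2 :=
    (((continuous_edgeInnerSum G).const_mul β).rexp).mul (by fun_prop)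
  have := Measure.pi.isOpenPosMeasure (fun _ : V => sphereUniform n)
  refine hcont.integral_pos_of_hasCompactSupport_nonneg_nonzero
    (HasCompactSupport.of_compactSpace _) (fun σ => by positivity)
    (x := fun _ => ⟨EuclideanSpace.single (0 : Fin n) (1 : ℝ), hx⟩) ?_
  refine mul_ne_zero (Real.exp_pos _).ne' ?_
  simp [Finset.sum_const, Finset.card_univ, norm_smul, ← Nat.cast_smul_eq_nsmul ℝ]

end StructureFactor

/-! ### The structure factor and the finite-volume bound. -/

section Torus

variable {d L n : ℕ} [NeZero L] [NeZero n]

lemma torusChar_zero_left (x : Fin d → ZMod (2 * L)) : torusChar 0 x = 1 := by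
  simp [torusChar]

/-- The infrared bound for the structure factor. -/
lemma integral_structureFactor_le (hL : 2 ≤ L) {β : ℝ} (hβ : 0 < β) {k : Fin d → ZMod (2 * L)}
    (hk : k ≠ 0) :
    ∫ σ, (∑ u, ∑ v, (torusChar k (u - v)).re * inner ℝ (σ u : EuclideanSpace ℝ (Fin n)) (σ v))
      ∂(spinMeasure (torusGraph d L) n β) ≤
      n * (2 * L : ℕ) ^ d / (2 * β) * (torusEigenvalue k)⁻¹ := by
  classical
  have hl := torusEigenvalue_pos hk
  -- Real and imaginary parts are real eigenfunctions with the same eigenvalue; adding their bounds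
  -- gives the kernel `Re χ_k(u - v)` and squared norm `(2L)^d`.
  have hre : ∀ u : Fin d → ZMod (2 * L), (∑ v, if (torusGraph d L).Adj u v then
      (torusChar k u).re - (torusChar k v).re else 0) =
      2 * torusEigenvalue k * (torusChar k u).re := by
    intro u
    have h := congrArg Complex.re (laplacian_torusChar hL k u)
    rw [Complex.re_sum, Complex.re_ofReal_mul] at h
    rw [← h]
    refine Finset.sum_congr rfl fun v _ => ?_
    split_ifs <;> simp
  have him : ∀ u : Fin d → ZMod (2 * L), (∑ v, if (torusGraph d L).Adj u v then
      (torusChar k u).im - (torusChar k v).im else 0) =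
      2 * torusEigenvalue k * (torusChar k u).im := by
    intro u
    have h := congrArg Complex.im (laplacian_torusChar hL k u)
    rw [Complex.im_sum, Complex.im_ofReal_mul] at h
    rw [← h]
    refine Finset.sum_congr rfl fun v _ => ?_
    split_ifs <;> simp
  have h1 := integral_quadratic_le (n := n) hasMirrors_torusGraph hβ hl hre
  have h2 := integral_quadratic_le (n := n) hasMirrors_torusGraph hβ hl him
  have hsum : ∀ u v : Fin d → ZMod (2 * L), (torusChar k (u - v)).re =
      (torusChar k u).re * (torusChar k v).re + (torusChar k u).im * (torusChar k v).im := by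
    intro u v
    rw [sub_eq_add_neg, torusChar_add, torusChar_neg]
    simp
  have hnorm : ∑ u, (torusChar k u).re ^ 2 + ∑ u, (torusChar k u).im ^ 2 =
      ((2 * L : ℕ) : ℝ) ^ d := by
    rw [← Finset.sum_add_distrib]
    have : ∀ u : Fin d → ZMod (2 * L), (torusChar k u).re ^ 2 + (torusChar k u).im ^ 2 = 1 := by
      intro u
      have := Complex.sq_norm (torusChar k u)
      rw [norm_torusChar, Complex.normSq_apply] at this
      linarith
    simp [this, ZMod.card]
  simp_rw [hsum, add_mul, Finset.sum_add_distrib]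
  rw [integral_add (integrable_spinMeasure _ _ (by fun_prop))
    (integrable_spinMeasure _ _ (by fun_prop))]
  refine (add_le_add h1 h2).trans_eq ?_
  rw [← add_div, ← mul_add, hnorm]
  field_simp

-- Parseval, valid for each `σ`: summing over `k` keeps only `u = v`, where `‖σ_u‖ = 1`.
omit [NeZero n] in
lemma sum_structureFactor (σ : (Fin d → ZMod (2 * L)) → SpinSphere n) :
    ∑ k, ∑ u, ∑ v, (torusChar k (u - v)).re * inner ℝ (σ u : EuclideanSpace ℝ (Fin n)) (σ v) =
      (((2 * L : ℕ) : ℝ) ^ d) ^ 2 := by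
  classical
  have h : ∀ z : Fin d → ZMod (2 * L), ∑ k, (torusChar k z).re =
      if z = 0 then ((2 * L : ℕ) : ℝ) ^ d else 0 := by
    intro z
    rw [← Complex.re_sum, sum_torusChar]
    split_ifs
    · exact_mod_cast Complex.ofReal_re (((2 * L : ℕ) : ℝ) ^ d)
    · simp
  rw [Finset.sum_comm]
  have h2 : ∀ u, ∑ k, ∑ v, (torusChar k (u - v)).re *
      inner ℝ (σ u : EuclideanSpace ℝ (Fin n)) (σ v) = ((2 * L : ℕ) : ℝ) ^ d := by
    intro u
    rw [Finset.sum_comm]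
    simp_rw [← Finset.sum_mul, h, sub_eq_zero, ite_mul, zero_mul]
    rw [Finset.sum_ite_eq, if_pos (Finset.mem_univ _), real_inner_self_eq_norm_sq,
      norm_eq_of_mem_sphere]
    ring
  simp_rw [h2]
  rw [Finset.sum_const, Finset.card_univ, nsmul_eq_mul, sq]
  simp [ZMod.card]

/-- The finite-volume bound on the averaged correlation. -/
theorem one_sub_le_averagedCorrelation (hL : 2 ≤ L) {β : ℝ} (hβ : 0 < β) :
    1 - n / (2 * β) * ((((2 * L : ℕ) : ℝ) ^ d)⁻¹ *
      ∑ k : Fin d → ZMod (2 * L), (torusEigenvalue k)⁻¹) ≤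
      averagedCorrelation (torusGraph d L) n β := by
  classical
  have hN : (0 : ℝ) < ((2 * L : ℕ) : ℝ) ^ d := by
    have : 0 < 2 * L := by omega
    positivity
  have hcard := card_sq_mul_averagedCorrelation (n := n) (torusGraph d L) β
  have hcV : (Fintype.card (Fin d → ZMod (2 * L)) : ℝ) = ((2 * L : ℕ) : ℝ) ^ d := by
    simp [ZMod.card]
  rw [hcV] at hcard
  have htot : ∑ k : Fin d → ZMod (2 * L), ∫ σ, (∑ u, ∑ v, (torusChar k (u - v)).re *
      inner ℝ (σ u : EuclideanSpace ℝ (Fin n)) (σ v)) ∂(spinMeasure (torusGraph d L) n β) =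
      (((2 * L : ℕ) : ℝ) ^ d) ^ 2 := by
    rw [← integral_finsetSum _ fun i _ => integrable_spinMeasure _ _ (by fun_prop)]
    simp_rw [sum_structureFactor]
    simp
  rw [← Finset.add_sum_erase _ _ (Finset.mem_univ 0)] at htot
  simp only [torusChar_zero_left, Complex.one_re, one_mul] at htot
  rw [← hcard] at htot
  have hrest := Finset.sum_le_sum (s := Finset.univ.erase (0 : Fin d → ZMod (2 * L)))
    fun k hk => integral_structureFactor_le (n := n) hL hβ (Finset.ne_of_mem_erase hk)
  -- The zero mode may be put back: its eigenvalue is 0, and `0⁻¹ = 0`.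
  rw [← Finset.mul_sum, Finset.sum_erase (f := fun k => (torusEigenvalue k)⁻¹) _
    (by simp [torusEigenvalue])] at hrest
  refine le_of_mul_le_mul_left ?_ (pow_pos hN 2)
  have e : (((2 * L : ℕ) : ℝ) ^ d) ^ 2 * (1 - n / (2 * β) * ((((2 * L : ℕ) : ℝ) ^ d)⁻¹ *
      ∑ k : Fin d → ZMod (2 * L), (torusEigenvalue k)⁻¹)) = (((2 * L : ℕ) : ℝ) ^ d) ^ 2 -
      n * ((2 * L : ℕ) : ℝ) ^ d / (2 * β) *
      ∑ k : Fin d → ZMod (2 * L), (torusEigenvalue k)⁻¹ := by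
    field_simp
  rw [e]
  linarith

end Torus

/-! ### The infrared integral over a full period. -/

section Cube

/-- The uniform measure on the unit cube. -/
noncomputable def cubeMeasure (d : ℕ) : Measure (Fin d → ℝ) :=
  Measure.pi fun _ => volume.restrict (Set.Ico (0 : ℝ) 1)

instance : IsProbabilityMeasure ((volume : Measure ℝ).restrict (Set.Ico (0 : ℝ) 1)) :=
  ⟨by simp⟩

instance (d : ℕ) : IsProbabilityMeasure (cubeMeasure d) := by
  unfold cubeMeasure; infer_instance

lemma infraredIntegral_eq (d : ℕ) : infraredIntegral d =
    ∫⁻ t, (ENNReal.ofReal (∑ j, (1 - Real.cos (Real.pi * t j))))⁻¹ ∂(cubeMeasure d) := by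
  have h : (volume : Measure (Fin d → ℝ)).restrict (Set.Icc 0 1) = cubeMeasure d := by
    have e : (Set.Icc (0 : Fin d → ℝ) 1) = Set.univ.pi fun _ => Set.Icc (0 : ℝ) 1 := by
      rw [Set.pi_univ_Icc]; rfl
    rw [e, volume_pi, Measure.restrict_pi_pi, cubeMeasure]
    congr 1
    ext1 j
    exact Measure.restrict_congr_set Ico_ae_eq_Icc.symm
  rw [infraredIntegral, h]

/-- The tent map preserves the uniform measure of the unit interval. -/
lemma measurePreserving_tent : MeasurePreserving (fun t : ℝ => 1 - |1 - 2 * t|)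
    (volume.restrict (Set.Ico 0 1)) (volume.restrict (Set.Ico 0 1)) := by
  rw [Measure.restrict_congr_set Ico_ae_eq_Icc]
  have hm : Measurable fun t : ℝ => 1 - |1 - 2 * t| := by fun_prop
  refine ⟨hm, Measure.ext_of_Ici _ _ fun a => ?_⟩
  rw [Measure.map_apply hm measurableSet_Ici, Measure.restrict_apply (hm measurableSet_Ici),
    Measure.restrict_apply measurableSet_Ici]
  have e1 : (fun t : ℝ => 1 - |1 - 2 * t|) ⁻¹' Set.Ici a ∩ Set.Icc 0 1 =
      Set.Icc (max a 0 / 2) (1 - max a 0 / 2) := by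
    ext t
    simp only [Set.mem_inter_iff, Set.mem_preimage, Set.mem_Ici, Set.mem_Icc]
    rw [le_sub_comm, abs_le]
    rcases max_cases a 0 with ⟨h, h'⟩ | ⟨h, h'⟩ <;> rw [h]
    · constructor
      · rintro ⟨⟨h1, h2⟩, h3, h4⟩; constructor <;> linarith
      · rintro ⟨h1, h2⟩; refine ⟨⟨?_, ?_⟩, ?_, ?_⟩ <;> linarith
    · constructor
      · rintro ⟨⟨h1, h2⟩, h3, h4⟩; constructor <;> linarith
      · rintro ⟨h1, h2⟩; refine ⟨⟨?_, ?_⟩, ?_, ?_⟩ <;> linarith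
  have e2 : Set.Ici a ∩ Set.Icc 0 1 = Set.Icc (max a 0) 1 := by
    ext t
    simp only [Set.mem_inter_iff, Set.mem_Ici, Set.mem_Icc, max_le_iff]
    tauto
  rw [e1, e2, Real.volume_Icc, Real.volume_Icc]
  congr 1
  ring

lemma cos_pi_mul_tent (t : ℝ) :
    Real.cos (Real.pi * (1 - |1 - 2 * t|)) = Real.cos (2 * Real.pi * t) := by
  rw [mul_sub, mul_one, Real.cos_pi_sub]
  have : Real.cos (Real.pi * |1 - 2 * t|) = Real.cos (Real.pi * (1 - 2 * t)) := by
    rcases abs_cases (1 - 2 * t) with ⟨h, -⟩ | ⟨h, -⟩ <;> rw [h]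
    rw [mul_neg, Real.cos_neg]
  rw [this, mul_sub, mul_one, Real.cos_pi_sub, neg_neg]
  ring_nf

/-- Pulling back along the tent map in each coordinate replaces a half period of the cosine by a
full one, which the modes `k / (2L)` run through. -/
lemma infraredIntegral_eq_two_pi (d : ℕ) : infraredIntegral d =
    ∫⁻ t, (ENNReal.ofReal (∑ j, (1 - Real.cos (2 * Real.pi * t j))))⁻¹ ∂(cubeMeasure d) := by
  have hp : MeasurePreserving (fun (t : Fin d → ℝ) j => 1 - |1 - 2 * t j|)
      (cubeMeasure d) (cubeMeasure d) :=
    measurePreserving_pi _ _ fun _ => measurePreserving_tent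
  rw [infraredIntegral_eq, ← hp.lintegral_comp (by fun_prop)]
  simp_rw [cos_pi_mul_tent]

end Cube

/-! ### Lattice means as integrals of step functions. -/

section RiemannSum

/-- The index of the mesh cell that contains `t`. -/
noncomputable def meshIndex (m : ℕ) (t : ℝ) : ZMod m := (⌊m * t⌋₊ : ℕ)

variable {m : ℕ} [NeZero m]

lemma val_meshIndex {t : ℝ} (ht : t ∈ Set.Ico (0 : ℝ) 1) :
    (meshIndex m t).val = ⌊m * t⌋₊ := by
  have hm : (0 : ℝ) < m := by exact_mod_cast Nat.pos_of_ne_zero (NeZero.ne m)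
  refine ZMod.val_natCast_of_lt ?_
  rw [Nat.floor_lt (mul_nonneg hm.le ht.1)]
  nlinarith [ht.2]

lemma measurePreserving_meshIndex :
    MeasurePreserving (meshIndex m) (volume.restrict (Set.Ico 0 1))
      ((m : ENNReal)⁻¹ • Measure.count) := by
  have hm : (0 : ℝ) < m := by exact_mod_cast Nat.pos_of_ne_zero (NeZero.ne m)
  have hmeas : Measurable (meshIndex m) := by
    have h1 : Measurable fun t : ℝ => ⌊m * t⌋₊ := Nat.measurable_floor.comp (by fun_prop)
    exact (measurable_from_top (f := fun k : ℕ => (k : ZMod m))).comp h1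
  refine ⟨hmeas, Measure.ext_of_singleton fun κ => ?_⟩
  have e : meshIndex m ⁻¹' {κ} ∩ Set.Ico 0 1 =
      Set.Ico ((κ.val : ℝ) / m) ((κ.val + 1 : ℝ) / m) := by
    ext t
    have hκ : (κ.val + 1 : ℝ) ≤ m := by exact_mod_cast ZMod.val_lt κ
    simp only [Set.mem_inter_iff, Set.mem_preimage, Set.mem_singleton_iff]
    rw [Set.mem_Ico (a := (κ.val : ℝ) / m), div_le_iff₀ hm, lt_div_iff₀ hm]
    constructor
    · rintro ⟨h, ht⟩
      rw [← h, val_meshIndex ht]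
      rw [mul_comm t]
      exact ⟨Nat.floor_le (mul_nonneg hm.le ht.1), Nat.lt_floor_add_one _⟩
    · rintro ⟨h1, h2⟩
      have h0 : (0 : ℝ) ≤ κ.val := by positivity
      have ht : t ∈ Set.Ico (0 : ℝ) 1 := ⟨by nlinarith, by nlinarith⟩
      refine ⟨ZMod.val_injective _ ?_, ht⟩
      rw [val_meshIndex ht, Nat.floor_eq_iff (mul_nonneg hm.le ht.1), mul_comm]
      exact ⟨h1, h2⟩
  rw [Measure.map_apply hmeas (measurableSet_singleton κ), Measure.restrict_apply
    (hmeas (measurableSet_singleton κ)), e, Real.volume_Ico, Measure.smul_apply,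
    Measure.count_singleton, smul_eq_mul, mul_one, ← sub_div, add_sub_cancel_left,
    ENNReal.ofReal_div_of_pos hm, ENNReal.ofReal_one, ENNReal.ofReal_natCast, one_div]

/-- The mean of a function over a discrete torus as an integral over the cube. -/
lemma integral_comp_meshIndex {d : ℕ} (F : (Fin d → ZMod m) → ℝ) :
    ∫ t, F (fun j => meshIndex m (t j)) ∂(cubeMeasure d) = ((m : ℝ) ^ d)⁻¹ * ∑ k, F k := by
  have hm0 : (m : ENNReal) ≠ 0 := by exact_mod_cast NeZero.ne m
  have : IsFiniteMeasure ((m : ENNReal)⁻¹ • (Measure.count : Measure (ZMod m))) :=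
    Measure.smul_finite _ (ENNReal.inv_ne_top.2 hm0)
  have hp : MeasurePreserving (fun (t : Fin d → ℝ) j => meshIndex m (t j))
      (cubeMeasure d) (Measure.pi fun _ => (m : ENNReal)⁻¹ • Measure.count) :=
    measurePreserving_pi _ _ fun _ => measurePreserving_meshIndex
  have hF : Measurable F := measurable_of_countable F
  have h := integral_map hp.measurable.aemeasurable (μ := cubeMeasure d) (f := F)
    hF.aestronglyMeasurable
  rw [← h, hp.map_eq, integral_fintype (Integrable.of_finite), Finset.mul_sum]
  refine Finset.sum_congr rfl fun k _ => ?_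
  rw [measureReal_def, Measure.pi_singleton]
  simp

end RiemannSum

/-! ### An integrable majorant for the step functions. -/

section Domination

variable {L : ℕ} [NeZero L]

lemma sin_sq_add_le {a δ : ℝ} : Real.sin (a + δ) ^ 2 ≤ 2 * Real.sin a ^ 2 + 2 * Real.sin δ ^ 2 := by
  rw [Real.sin_add]
  have h1 := Real.sin_sq_add_cos_sq a
  have h2 := Real.sin_sq_add_cos_sq δ
  have h3 : (Real.sin a * Real.cos δ) ^ 2 ≤ Real.sin a ^ 2 := by
    rw [mul_pow]
    nlinarith [sq_nonneg (Real.sin a), sq_nonneg (Real.sin δ)]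
  have h4 : (Real.cos a * Real.sin δ) ^ 2 ≤ Real.sin δ ^ 2 := by
    rw [mul_pow]
    nlinarith [sq_nonneg (Real.sin a), sq_nonneg (Real.sin δ)]
  nlinarith [sq_nonneg (Real.sin a * Real.cos δ - Real.cos a * Real.sin δ)]

lemma one_sub_cos_eq (x : ℝ) : 1 - Real.cos (2 * x) = 2 * Real.sin x ^ 2 := by
  rw [Real.cos_two_mul, Real.cos_sq']
  ring

/-- In half-angle form `1 - cos 2x = 2 sin² x`, moving `t` to the left end of its cell changes the
angle by at most `π / (2L) ≤ π / 2`. -/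
lemma one_sub_cos_two_pi_le {t : ℝ} (ht : t ∈ Set.Ico (0 : ℝ) 1) :
    1 - Real.cos (2 * Real.pi * t) ≤
      2 * (1 - Real.cos (Real.pi * ((meshIndex (2 * L) t).val / L))) +
      2 * (1 - Real.cos (Real.pi / L)) := by
  have hL : (0 : ℝ) < L := by exact_mod_cast Nat.pos_of_ne_zero (NeZero.ne L)
  have hL1 : (1 : ℝ) ≤ L := by exact_mod_cast Nat.pos_of_ne_zero (NeZero.ne L)
  rw [val_meshIndex ht]
  set v := ⌊((2 * L : ℕ) : ℝ) * t⌋₊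
  have hv1 : (v : ℝ) ≤ ((2 * L : ℕ) : ℝ) * t := Nat.floor_le (mul_nonneg (by positivity) ht.1)
  have hv2 : ((2 * L : ℕ) : ℝ) * t < v + 1 := Nat.lt_floor_add_one _
  push_cast at hv1 hv2
  have hpi := Real.pi_pos
  have e1 : 2 * Real.pi * t = 2 * (Real.pi * v / (2 * L) + (Real.pi * t - Real.pi * v / (2 * L))) := by
    ring
  have e2 : Real.pi * (v / L) = 2 * (Real.pi * v / (2 * L)) := by field_simp
  have e3 : Real.pi / L = 2 * (Real.pi / (2 * L)) := by field_simp
  rw [e1, e2, e3, one_sub_cos_eq, one_sub_cos_eq, one_sub_cos_eq]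
  have h0 : 0 ≤ Real.pi * t - Real.pi * v / (2 * L) := by
    rw [sub_nonneg, div_le_iff₀ (by positivity)]
    nlinarith
  have h1 : Real.pi * t - Real.pi * v / (2 * L) ≤ Real.pi / (2 * L) := by
    rw [sub_le_iff_le_add, ← add_div, le_div_iff₀ (by positivity)]
    nlinarith
  have h2 : Real.pi / (2 * L) ≤ Real.pi / 2 := by
    apply div_le_div_of_nonneg_left hpi.le <;> linarith
  have hs : Real.sin (Real.pi * t - Real.pi * v / (2 * L)) ≤ Real.sin (Real.pi / (2 * L)) :=
    Real.sin_le_sin_of_le_of_le_pi_div_two (by linarith) h2 h1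
  have hs0 : 0 ≤ Real.sin (Real.pi * t - Real.pi * v / (2 * L)) :=
    Real.sin_nonneg_of_nonneg_of_le_pi h0 (by linarith)
  have := sin_sq_add_le (a := Real.pi * v / (2 * L)) (δ := Real.pi * t - Real.pi * v / (2 * L))
  have hsq := pow_le_pow_left₀ hs0 hs 2
  linarith

lemma one_sub_cos_pi_div_le {v : ℕ} (hv : v ≠ 0) (hvL : v < 2 * L) :
    1 - Real.cos (Real.pi / L) ≤ 1 - Real.cos (Real.pi * (v / L)) := by
  have hL : (0 : ℝ) < L := by exact_mod_cast Nat.pos_of_ne_zero (NeZero.ne L)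
  have hv1 : (1 : ℝ) ≤ v := by exact_mod_cast Nat.pos_of_ne_zero hv
  have hv2 : (v : ℝ) + 1 ≤ 2 * L := by exact_mod_cast hvL
  have hpi := Real.pi_pos
  have hle : Real.pi / L ≤ Real.pi * (v / L) := by
    rw [← mul_div_assoc]
    gcongr
    nlinarith
  have h0 : 0 ≤ Real.pi / L := by positivity
  refine sub_le_sub_left ?_ _
  by_cases h : Real.pi * (v / L) ≤ Real.pi
  · exact Real.cos_le_cos_of_nonneg_of_le_pi h0 h hle
  · rw [← Real.cos_two_pi_sub (Real.pi * (v / L))]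
    refine Real.cos_le_cos_of_nonneg_of_le_pi h0 (by linarith) ?_
    rw [div_le_iff₀ hL]
    field_simp
    linarith

/-- Each of the `d` coordinates contributes an error `2 (1 - cos (π / L))`. Since `1 - cos (π / L)`
is the least nonzero eigenvalue in one dimension, it is at most the eigenvalue of `k ≠ 0`; hence `2
+ 2d`. -/
lemma sum_one_sub_cos_le {d : ℕ} {t : Fin d → ℝ} (ht : ∀ j, t j ∈ Set.Ico (0 : ℝ) 1)
    (hk : (fun j => meshIndex (2 * L) (t j)) ≠ 0) :
    ∑ j, (1 - Real.cos (2 * Real.pi * t j)) ≤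
      (2 + 2 * d) * torusEigenvalue fun j => meshIndex (2 * L) (t j) := by
  obtain ⟨i, hi⟩ := Function.ne_iff.1 hk
  have h1 : 1 - Real.cos (Real.pi / L) ≤ torusEigenvalue fun j => meshIndex (2 * L) (t j) := by
    rw [torusEigenvalue_eq]
    refine (one_sub_cos_pi_div_le ((ZMod.val_ne_zero _).2 hi) (ZMod.val_lt _)).trans ?_
    exact Finset.single_le_sum
      (f := fun j => 1 - Real.cos (Real.pi * ((meshIndex (2 * L) (t j)).val / L)))
      (fun j _ => sub_nonneg.2 (Real.cos_le_one _)) (Finset.mem_univ i)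
  calc ∑ j, (1 - Real.cos (2 * Real.pi * t j))
      ≤ ∑ j, (2 * (1 - Real.cos (Real.pi * ((meshIndex (2 * L) (t j)).val / L))) +
        2 * (1 - Real.cos (Real.pi / L))) :=
        Finset.sum_le_sum fun j _ => one_sub_cos_two_pi_le (ht j)
    _ = 2 * torusEigenvalue (fun j => meshIndex (2 * L) (t j)) +
        d * (2 * (1 - Real.cos (Real.pi / L))) := by
        rw [Finset.sum_add_distrib, ← Finset.mul_sum, torusEigenvalue_eq]
        simp
    _ ≤ _ := by
      have := mul_le_mul_of_nonneg_left h1 (show (0 : ℝ) ≤ 2 * d by positivity)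
      linarith

end Domination

lemma tendsto_val_meshIndex_div {t : ℝ} (ht : t ∈ Set.Ico (0 : ℝ) 1) :
    Tendsto (fun L : ℕ+ => ((meshIndex (2 * L) t).val : ℝ) / (L : ℕ)) atTop (𝓝 (2 * t)) := by
  have h2 : Tendsto (fun L : ℕ+ => ((L : ℕ) : ℝ)) atTop atTop :=
    tendsto_natCast_atTop_atTop.comp tendsto_PNat_val_atTop_atTop
  have h3 := (tendsto_nat_floor_mul_div_atTop (R := ℝ) (a := 2 * t)
    (mul_nonneg zero_le_two ht.1)).comp h2
  refine h3.congr fun L => ?_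
  have e : (meshIndex (2 * (L : ℕ)) t).val = ⌊2 * t * ((L : ℕ) : ℝ)⌋₊ := by
    rw [val_meshIndex ht]
    congr 1
    push_cast
    ring
  rw [Function.comp_apply, e]

/-- Convergence of the lattice sums to the infrared integral. -/
theorem tendsto_sum_inv_torusEigenvalue {d : ℕ} (hd : infraredIntegral d ≠ ⊤) :
    Tendsto (fun L : ℕ+ => (((2 * L : ℕ) : ℝ) ^ d)⁻¹ *
      ∑ k : Fin d → ZMod (2 * L), (torusEigenvalue k)⁻¹) atTop
      (𝓝 (infraredIntegral d).toReal) := by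
  rw [infraredIntegral_eq_two_pi] at hd ⊢
  have hmeas : Measurable fun t : Fin d → ℝ =>
    (ENNReal.ofReal (∑ j, (1 - Real.cos (2 * Real.pi * t j))))⁻¹ := by fun_prop
  have hlt := ae_lt_top hmeas hd
  have hS : ∀ t : Fin d → ℝ, 0 ≤ ∑ j, (1 - Real.cos (2 * Real.pi * t j)) := fun t =>
    Finset.sum_nonneg fun j _ => sub_nonneg.2 (Real.cos_le_one _)
  have htoReal : ∀ t : Fin d → ℝ,
      ((ENNReal.ofReal (∑ j, (1 - Real.cos (2 * Real.pi * t j))))⁻¹).toReal =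
      (∑ j, (1 - Real.cos (2 * Real.pi * t j)))⁻¹ := fun t => by
    rw [ENNReal.toReal_inv, ENNReal.toReal_ofReal (hS t)]
  have hint := integrable_toReal_of_lintegral_ne_top hmeas.aemeasurable hd
  rw [← integral_toReal hmeas.aemeasurable hlt]
  simp_rw [htoReal] at hint ⊢
  simp_rw [← integral_comp_meshIndex]
  have hIco : ∀ᵐ t ∂(cubeMeasure d), ∀ j, t j ∈ Set.Ico (0 : ℝ) 1 := by
    rw [ae_all_iff]
    intro j
    exact (Measure.quasiMeasurePreserving_eval
      (fun _ : Fin d => volume.restrict (Set.Ico (0 : ℝ) 1)) j).ae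
      (ae_restrict_mem measurableSet_Ico)
  refine tendsto_integral_filter_of_dominated_convergence
    (fun t => (2 + 2 * d) * (∑ j, (1 - Real.cos (2 * Real.pi * t j)))⁻¹) ?_ ?_
    (hint.const_mul _) ?_
  · refine Eventually.of_forall fun L => Measurable.aestronglyMeasurable ?_
    have h1 : Measurable fun (t : Fin d → ℝ) j => meshIndex (2 * L) (t j) :=
      measurable_pi_iff.2 fun j =>
        (measurePreserving_meshIndex (m := 2 * L)).measurable.comp (measurable_pi_apply j)
    exact (measurable_of_countable
      (fun k : Fin d → ZMod (2 * L) => (torusEigenvalue k)⁻¹)).comp h1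
  · refine Eventually.of_forall fun L => ?_
    filter_upwards [hIco, hlt] with t ht hfin
    -- On the cell of the origin the step function is `0⁻¹ = 0`, so the singularity needs no
    -- estimate there.
    by_cases hk : (fun j => meshIndex (2 * L) (t j)) = 0
    · rw [hk]
      have : torusEigenvalue (0 : Fin d → ZMod (2 * L)) = 0 := by simp [torusEigenvalue]
      rw [this, inv_zero, norm_zero]
      exact mul_nonneg (by positivity) (inv_nonneg.2 (hS t))
    · have hpos := torusEigenvalue_pos hk
      have hSpos : 0 < ∑ j, (1 - Real.cos (2 * Real.pi * t j)) := by
        simpa using hfin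
      rw [Real.norm_of_nonneg (inv_nonneg.2 hpos.le), ← div_eq_mul_inv, le_div_iff₀ hSpos,
        inv_mul_le_iff₀ hpos]
      exact (sum_one_sub_cos_le ht hk).trans_eq (mul_comm _ _)
  · filter_upwards [hIco, hlt] with t ht hfin
    have hSpos : 0 < ∑ j, (1 - Real.cos (2 * Real.pi * t j)) := by
      simpa using hfin
    refine Tendsto.inv₀ ?_ hSpos.ne'
    simp_rw [torusEigenvalue_eq]
    refine tendsto_finsetSum _ fun j _ => ?_
    have h := (Real.continuous_cos.tendsto _).comp
      ((tendsto_val_meshIndex_div (ht j)).const_mul Real.pi)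
    rw [show Real.pi * (2 * t j) = 2 * Real.pi * t j by ring] at h
    exact h.const_sub 1

/-! ### Finiteness and asymptotics of the infrared integral. -/

section LaplaceTransform

lemma integrable_unit_of_continuous {f : ℝ → ℝ} (hf : Continuous f) :
    Integrable f ((volume : Measure ℝ).restrict (Set.Ico 0 1)) :=
  (hf.integrableOn_Icc (a := 0) (b := 1)).mono_set Set.Ico_subset_Icc_self

/-- The Laplace transform of `1 - cos (π U)` for `U` uniform on the unit interval. -/
noncomputable def cosLaplace (s : ℝ) : ℝ :=
  ∫ u in Set.Ico (0 : ℝ) 1, Real.exp (-s * (1 - Real.cos (Real.pi * u)))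

lemma cosLaplace_pos (s : ℝ) : 0 < cosLaplace s :=
  integral_exp_pos (integrable_unit_of_continuous (by fun_prop))

lemma measurable_cosLaplace : Measurable cosLaplace := by
  unfold cosLaplace
  refine (StronglyMeasurable.integral_prod_right'
    (f := fun p : ℝ × ℝ => Real.exp (-p.1 * (1 - Real.cos (Real.pi * p.2)))) ?_).measurable
  exact Continuous.stronglyMeasurable (by fun_prop)

lemma inv_ofReal_eq_lintegral_exp {x : ℝ} (hx : 0 ≤ x) :
    (ENNReal.ofReal x)⁻¹ = ∫⁻ s in Set.Ioi (0 : ℝ), ENNReal.ofReal (Real.exp (-s * x)) := by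
  rcases hx.eq_or_lt with rfl | hx
  · simp
  · have e : ∀ s : ℝ, -s * x = -x * s := fun s => by ring
    simp_rw [e]
    rw [← ofReal_integral_eq_lintegral_ofReal (integrableOn_exp_mul_Ioi (by linarith) 0)
      (Eventually.of_forall fun _ => by positivity), integral_exp_mul_Ioi (by linarith),
      ← ENNReal.ofReal_inv_of_pos hx]
    congr 1
    simp

/-- Tonelli, after which the exponential of a sum over coordinates integrates to a product of equal
factors. -/
lemma infraredIntegral_eq_lintegral_cosLaplace (d : ℕ) :
    infraredIntegral d = ∫⁻ s in Set.Ioi (0 : ℝ), ENNReal.ofReal (cosLaplace s ^ d) := by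
  have hS : ∀ t : Fin d → ℝ, 0 ≤ ∑ j, (1 - Real.cos (Real.pi * t j)) := fun t =>
    Finset.sum_nonneg fun j _ => sub_nonneg.2 (Real.cos_le_one _)
  rw [infraredIntegral_eq]
  simp_rw [inv_ofReal_eq_lintegral_exp (hS _)]
  rw [lintegral_lintegral_swap]
  · refine lintegral_congr fun s => ?_
    have e : ∀ t : Fin d → ℝ, Real.exp (-s * ∑ j, (1 - Real.cos (Real.pi * t j))) =
        ∏ j, Real.exp (-s * (1 - Real.cos (Real.pi * t j))) := fun t => by
      rw [Finset.mul_sum, Real.exp_sum]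
    have hprod : ∫ t, ∏ j, Real.exp (-s * (1 - Real.cos (Real.pi * t j))) ∂(cubeMeasure d) =
        cosLaplace s ^ d := by
      have := integral_fintype_prod_eq_pow (ι := Fin d)
        (μ := (volume : Measure ℝ).restrict (Set.Ico 0 1))
        (fun u => Real.exp (-s * (1 - Real.cos (Real.pi * u))))
      rwa [Fintype.card_fin] at this
    simp_rw [e]
    rw [← hprod, ofReal_integral_eq_lintegral_ofReal _ (Eventually.of_forall fun t =>
      Finset.prod_nonneg fun j _ => (Real.exp_pos _).le)]
    refine Integrable.of_integral_ne_zero ?_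
    rw [hprod]
    exact pow_ne_zero _ (cosLaplace_pos s).ne'
  · refine Measurable.aemeasurable ?_
    unfold Function.uncurry
    fun_prop

lemma two_mul_sq_le_one_sub_cos {u : ℝ} (h0 : 0 ≤ u) (h1 : u ≤ 1) :
    2 * u ^ 2 ≤ 1 - Real.cos (Real.pi * u) := by
  have hpi := Real.pi_pos
  have h := Real.mul_le_sin (x := Real.pi * u / 2) (by positivity) (by nlinarith)
  have e : 2 / Real.pi * (Real.pi * u / 2) = u := by field_simp
  rw [e] at h
  rw [show Real.pi * u = 2 * (Real.pi * u / 2) by ring, one_sub_cos_eq]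
  have := pow_le_pow_left₀ h0 h 2
  linarith

lemma exp_neg_half_le (y : ℝ) (hy : 0 ≤ y) : Real.exp (-(y / 2)) ≤ (√(1 + y))⁻¹ := by
  rw [Real.exp_neg]
  refine inv_anti₀ (Real.sqrt_pos.2 (by linarith)) ?_
  rw [Real.exp_half]
  exact Real.sqrt_le_sqrt (by linarith [Real.add_one_le_exp y])

/-- The power three is chosen because `u / √(1 + b u²)` is then an antiderivative. -/
lemma integral_inv_sqrt_pow_three {b : ℝ} (hb : 0 ≤ b) :
    ∫ u in Set.Ico (0 : ℝ) 1, (√(1 + b * u ^ 2))⁻¹ ^ 3 = (√(1 + b))⁻¹ := by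
  have hpos : ∀ u : ℝ, 0 < 1 + b * u ^ 2 := fun u => by positivity
  have hcont : Continuous fun u : ℝ => (√(1 + b * u ^ 2))⁻¹ ^ 3 :=
    ((Real.continuous_sqrt.comp (by fun_prop)).inv₀
      fun u => (Real.sqrt_pos.2 (hpos u)).ne').pow 3
  have hder : ∀ u : ℝ, HasDerivAt (fun u : ℝ => u / √(1 + b * u ^ 2))
      ((√(1 + b * u ^ 2))⁻¹ ^ 3) u := by
    intro u
    have h1 : HasDerivAt (fun u : ℝ => 1 + b * u ^ 2) (b * (2 * u)) u := by
      simpa using (((hasDerivAt_pow 2 u).const_mul b).const_add 1)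
    have hs := Real.sqrt_pos.2 (hpos u)
    have hsq := Real.sq_sqrt (hpos u).le
    refine ((hasDerivAt_id u).fun_div (h1.sqrt (hpos u).ne') hs.ne').congr_deriv ?_
    simp only [id]
    field_simp
    rw [hsq]
    ring
  rw [← integral_Icc_eq_integral_Ico, integral_Icc_eq_integral_Ioc,
    ← intervalIntegral.integral_of_le zero_le_one,
    intervalIntegral.integral_eq_sub_of_hasDerivAt (fun u _ => hder u)
      (hcont.intervalIntegrable _ _)]
  simp

/-- By Jordan's inequality the integrand is at most `exp (-2 s u²)`, the cube of `exp (-y / 2)` with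
`y = 4 s u² / 3`; each factor is at most `(1 + y)^(-1/2)`. -/
lemma cosLaplace_le {s : ℝ} (hs : 0 ≤ s) : cosLaplace s ≤ (√(1 + 4 / 3 * s))⁻¹ := by
  rw [← integral_inv_sqrt_pow_three (by positivity)]
  have hcont : Continuous fun u : ℝ => (√(1 + 4 / 3 * s * u ^ 2))⁻¹ ^ 3 :=
    ((Real.continuous_sqrt.comp (by fun_prop)).inv₀
      fun u => (Real.sqrt_pos.2 (by positivity)).ne').pow 3
  refine setIntegral_mono_on (integrable_unit_of_continuous (by fun_prop))
    (integrable_unit_of_continuous hcont) measurableSet_Ico fun u hu => ?_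
  have h1 := mul_le_mul_of_nonneg_left (two_mul_sq_le_one_sub_cos hu.1 hu.2.le) hs
  calc Real.exp (-s * (1 - Real.cos (Real.pi * u)))
      ≤ Real.exp (-(4 / 3 * s * u ^ 2 / 2)) ^ 3 := by
        rw [← Real.exp_nat_mul, Real.exp_le_exp]
        push_cast
        linarith
    _ ≤ _ := pow_le_pow_left₀ (Real.exp_pos _).le (exp_neg_half_le _ (by positivity)) 3

/-- Bernoulli's inequality with exponent `d / 3 ≥ 1`. It yields a majorant independent of `d`. -/
lemma one_add_div_three_pow_le {x : ℝ} (hx : 0 ≤ x) {d : ℕ} (hd : 3 ≤ d) :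
    (1 + x / 3) ^ 3 ≤ (1 + x / d) ^ d := by
  have hd0 : (0 : ℝ) < d := by positivity
  have hd3 : (3 : ℝ) ≤ d := by exact_mod_cast hd
  have h := one_add_mul_self_le_rpow_one_add (s := x / d)
    (by have : 0 ≤ x / d := by positivity
        linarith) (p := d / 3) (by linarith)
  rw [show (d : ℝ) / 3 * (x / d) = x / 3 by field_simp] at h
  calc (1 + x / 3) ^ 3 ≤ ((1 + x / d) ^ ((d : ℝ) / 3)) ^ 3 :=
        pow_le_pow_left₀ (by positivity) h 3
    _ = _ := by
      rw [← Real.rpow_natCast, ← Real.rpow_mul (by positivity), ← Real.rpow_natCast]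
      congr 1
      push_cast
      ring

lemma cosLaplace_div_pow_le {s : ℝ} (hs : 0 ≤ s) {d : ℕ} (hd : 3 ≤ d) :
    cosLaplace (s / d) ^ d ≤ (√(1 + 4 / 9 * s))⁻¹ ^ 3 := by
  refine (pow_le_pow_left₀ (cosLaplace_pos _).le (cosLaplace_le (by positivity)) d).trans ?_
  rw [inv_pow, inv_pow]
  have h := Real.sqrt_le_sqrt (one_add_div_three_pow_le (x := 4 / 3 * s) (by positivity) hd)
  have e : ∀ (x : ℝ) (k : ℕ), 0 ≤ x → √(x ^ k) = √x ^ k := fun x k hx => by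
    rw [Real.sqrt_eq_iff_mul_self_eq (by positivity) (by positivity), ← mul_pow,
      Real.mul_self_sqrt hx]
  rw [e _ _ (by positivity), e _ _ (by positivity)] at h
  rw [show 4 / 3 * s / 3 = 4 / 9 * s by ring, show 4 / 3 * s / d = 4 / 3 * (s / d) by ring] at h
  exact inv_anti₀ (by positivity) h

lemma integrableOn_inv_sqrt_pow_three {c : ℝ} (hc : 0 < c) :
    IntegrableOn (fun s : ℝ => (√(1 + c * s))⁻¹ ^ 3) (Set.Ioi 0) := by
  have h := (integrableOn_add_rpow_Ioi_of_lt (a := -3 / 2) (c := 0) (m := c⁻¹) (by norm_num)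
    (by simpa using hc)).const_mul (c ^ (-3 / 2 : ℝ))
  refine IntegrableOn.congr_fun h (fun s hs => ?_) measurableSet_Ioi
  have hs0 : 0 < s := hs
  rw [← Real.mul_rpow hc.le (by positivity), mul_add, mul_inv_cancel₀ hc.ne', add_comm,
    Real.sqrt_eq_rpow, ← Real.rpow_neg (by positivity), ← Real.rpow_natCast,
    ← Real.rpow_mul (by positivity)]
  norm_num

lemma integrableOn_cosLaplace_div_pow {d : ℕ} (hd : 3 ≤ d) :
    IntegrableOn (fun s => cosLaplace (s / d) ^ d) (Set.Ioi 0) := by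
  refine Integrable.mono' (integrableOn_inv_sqrt_pow_three (c := 4 / 9) (by norm_num))
    ((measurable_cosLaplace.comp (measurable_id.div_const _)).pow_const d).aestronglyMeasurable ?_
  filter_upwards [ae_restrict_mem measurableSet_Ioi] with s hs
  rw [Real.norm_of_nonneg (pow_nonneg (cosLaplace_pos _).le _)]
  exact cosLaplace_div_pow_le (le_of_lt hs) hd

lemma integrableOn_cosLaplace_pow {d : ℕ} (hd : 3 ≤ d) :
    IntegrableOn (fun s => cosLaplace s ^ d) (Set.Ioi 0) := by
  have hd0 : (0 : ℝ) < d := by positivity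
  have h := (integrableOn_Ioi_comp_mul_left_iff (fun s => cosLaplace (s / d) ^ d) 0 hd0).2
    (by simpa using integrableOn_cosLaplace_div_pow hd)
  simpa [mul_div_cancel_left₀ _ hd0.ne'] using h

theorem infraredIntegral_lt_top {d : ℕ} (hd : 3 ≤ d) : infraredIntegral d < ⊤ := by
  rw [infraredIntegral_eq_lintegral_cosLaplace]
  exact (integrableOn_cosLaplace_pow hd).lintegral_lt_top

lemma mul_toReal_infraredIntegral {d : ℕ} (hd : 3 ≤ d) :
    d * (infraredIntegral d).toReal = ∫ s in Set.Ioi (0 : ℝ), cosLaplace (s / d) ^ d := by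
  have hd0 : (0 : ℝ) < d := by positivity
  rw [infraredIntegral_eq_lintegral_cosLaplace,
    ← integral_eq_lintegral_of_nonneg_ae
      (Eventually.of_forall fun s => pow_nonneg (cosLaplace_pos _).le _)
      (measurable_cosLaplace.pow_const d).aestronglyMeasurable]
  have h := integral_comp_mul_left_Ioi (fun s => cosLaplace s ^ d) 0 (inv_pos.2 hd0)
  simp only [mul_zero, inv_inv, smul_eq_mul] at h
  rw [← h]
  simp_rw [inv_mul_eq_div]

/-- The variable `1 - cos (π u)` has mean one and values in `[0, 2]`. For `s ≤ 1 / 2` the exponent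
`x` lies in `[-1, 0]`, where `|exp x - 1 - x| ≤ x² ≤ 4 s²`. -/
lemma abs_cosLaplace_sub_le {s : ℝ} (hs : 0 ≤ s) (hs' : s ≤ 1 / 2) :
    |cosLaplace s - 1 + s| ≤ 4 * s ^ 2 := by
  have hmean : ∫ u in Set.Ico (0 : ℝ) 1, (1 - Real.cos (Real.pi * u)) = 1 := by
    rw [integral_sub (integrable_const _) (integrable_unit_of_continuous (by fun_prop)),
      ← integral_Icc_eq_integral_Ico (f := fun u => Real.cos (Real.pi * u)),
      integral_Icc_eq_integral_Ioc, ← intervalIntegral.integral_of_le zero_le_one,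
      intervalIntegral.integral_comp_mul_left _ Real.pi_ne_zero]
    simp
  have e : cosLaplace s - 1 + s = ∫ u in Set.Ico (0 : ℝ) 1,
      (Real.exp (-s * (1 - Real.cos (Real.pi * u))) - 1 - (-s * (1 - Real.cos (Real.pi * u)))) := by
    rw [integral_sub (integrable_unit_of_continuous (by fun_prop))
      (integrable_unit_of_continuous (by fun_prop)),
      integral_sub (integrable_unit_of_continuous (by fun_prop)) (integrable_const _),
      integral_const_mul, hmean, cosLaplace]
    simp
  rw [e, ← Real.norm_eq_abs]
  refine (norm_integral_le_of_norm_le_const (C := 4 * s ^ 2)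
    (Eventually.of_forall fun u => ?_)).trans (by simp)
  have h1 := Real.cos_le_one (Real.pi * u)
  have h2 := Real.neg_one_le_cos (Real.pi * u)
  rw [Real.norm_eq_abs]
  refine (Real.abs_exp_sub_one_sub_id_le ?_).trans ?_
  · rw [abs_le]; constructor <;> nlinarith
  · rw [neg_mul, neg_sq, mul_pow, mul_comm]
    refine mul_le_mul_of_nonneg_right ?_ (sq_nonneg s)
    nlinarith

lemma tendsto_cosLaplace_div_pow {s : ℝ} (hs : 0 ≤ s) :
    Tendsto (fun d : ℕ => cosLaplace (s / d) ^ d) atTop (𝓝 (Real.exp (-s))) := by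
  have h : Tendsto (fun d : ℕ => (d : ℝ) * (cosLaplace (s / d) - 1)) atTop (𝓝 (-s)) := by
    rw [tendsto_iff_norm_sub_tendsto_zero]
    refine squeeze_zero' (g := fun d : ℕ => 4 * s ^ 2 / (d : ℝ))
      (Eventually.of_forall fun _ => norm_nonneg _) ?_ (tendsto_const_div_atTop_nhds_zero_nat _)
    filter_upwards [eventually_gt_atTop 0, eventually_ge_atTop ⌈2 * s⌉₊] with d hd hds
    have hd0 : (0 : ℝ) < d := by exact_mod_cast hd
    have hds' : 2 * s ≤ d := Nat.ceil_le.1 hds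
    have := abs_cosLaplace_sub_le (s := s / d) (by positivity)
      (by rw [div_le_iff₀ hd0]; linarith)
    rw [Real.norm_eq_abs, show (d : ℝ) * (cosLaplace (s / d) - 1) - -s =
      d * (cosLaplace (s / d) - 1 + s / d) by field_simp; ring, abs_mul, abs_of_pos hd0]
    calc (d : ℝ) * |cosLaplace (s / d) - 1 + s / d| ≤ d * (4 * (s / d) ^ 2) := by gcongr
      _ = _ := by field_simp
  simpa using Real.tendsto_one_add_pow_exp_of_tendsto h

theorem tendsto_mul_toReal_infraredIntegral :
    Tendsto (fun d : ℕ => d * (infraredIntegral d).toReal) atTop (𝓝 1) := by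
  have h : Tendsto (fun d : ℕ => ∫ s in Set.Ioi (0 : ℝ), cosLaplace (s / d) ^ d) atTop
      (𝓝 (∫ s in Set.Ioi (0 : ℝ), Real.exp (-s))) := by
    refine tendsto_integral_filter_of_dominated_convergence
      (fun s => (√(1 + 4 / 9 * s))⁻¹ ^ 3) ?_ ?_ (integrableOn_inv_sqrt_pow_three (by norm_num)) ?_
    · exact Eventually.of_forall fun d =>
        ((measurable_cosLaplace.comp (measurable_id.div_const _)).pow_const d).aestronglyMeasurable
    · filter_upwards [eventually_ge_atTop 3] with d hd
      filter_upwards [ae_restrict_mem measurableSet_Ioi] with s hs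
      rw [Real.norm_of_nonneg (pow_nonneg (cosLaplace_pos _).le _)]
      exact cosLaplace_div_pow_le (le_of_lt hs) hd
    · filter_upwards [ae_restrict_mem measurableSet_Ioi] with s hs
      exact tendsto_cosLaplace_div_pow (le_of_lt hs)
  rw [integral_exp_neg_Ioi_zero] at h
  refine h.congr' ?_
  filter_upwards [eventually_ge_atTop 3] with d hd
  exact (mul_toReal_infraredIntegral hd).symm

end LaplaceTransform

/-! ### Passage to the limit in `L`. -/

section LongRangeOrder

variable {d n : ℕ} [NeZero n] {β : ℝ}

lemma eventually_le_averagedCorrelation (hβ : 0 < β) : ∀ᶠ L : ℕ+ in atTop,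
    1 - n / (2 * β) * ((((2 * L : ℕ) : ℝ) ^ d)⁻¹ *
      ∑ k : Fin d → ZMod (2 * L), (torusEigenvalue k)⁻¹) ≤
      averagedCorrelation (torusGraph d L) n β := by
  filter_upwards [eventually_ge_atTop 2] with L hL
  exact one_sub_le_averagedCorrelation (L := L) (by exact_mod_cast hL) hβ

omit [NeZero n] in
lemma tendsto_lower_bound (hd : infraredIntegral d ≠ ⊤) :
    Tendsto (fun L : ℕ+ => 1 - n / (2 * β) * ((((2 * L : ℕ) : ℝ) ^ d)⁻¹ *
      ∑ k : Fin d → ZMod (2 * L), (torusEigenvalue k)⁻¹)) atTop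
      (𝓝 (1 - n / (2 * β) * (infraredIntegral d).toReal)) :=
  ((tendsto_sum_inv_torusEigenvalue hd).const_mul _).const_sub 1

theorem le_liminf_averagedCorrelation (hβ : 0 < β) :
    (1 : EReal) - (((n : ℝ) / (2 * β) : ℝ) : EReal) * (infraredIntegral d : EReal) ≤
      liminf (fun L : ℕ+ => ((averagedCorrelation (torusGraph d L) n β : ℝ) : EReal)) atTop := by
  have hn : (0 : ℝ) < n := by exact_mod_cast Nat.pos_of_ne_zero (NeZero.ne n)
  by_cases hd : infraredIntegral d = ⊤
  · rw [hd, EReal.coe_ennreal_top, EReal.coe_mul_top_of_pos (by positivity), EReal.sub_top]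
    exact bot_le
  · have e : (infraredIntegral d : EReal) = ((infraredIntegral d).toReal : EReal) :=
      (EReal.coe_ennreal_toReal hd).symm
    have h := (continuous_coe_real_ereal.tendsto _).comp (tendsto_lower_bound (n := n) (β := β) hd)
    have e2 : (1 : EReal) - (((n : ℝ) / (2 * β) : ℝ) : EReal) * (infraredIntegral d : EReal) =
        ((1 - n / (2 * β) * (infraredIntegral d).toReal : ℝ) : EReal) := by
      rw [e]
      push_cast
      rfl
    rw [e2, ← h.liminf_eq]
    refine liminf_le_liminf ?_
    filter_upwards [eventually_le_averagedCorrelation (d := d) (n := n) hβ] with L hL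
    exact EReal.coe_le_coe_iff.2 hL

/-- Any `b` strictly between 0 and the limiting bound works for large `L`; the remaining finitely
many values of `L` have a positive minimum. -/
theorem exists_pos_le_averagedCorrelation (hd : infraredIntegral d ≠ ⊤) (hβ : 0 < β)
    (hβd : 0 < 1 - n / (2 * β) * (infraredIntegral d).toReal) :
    ∃ c : ℝ, 0 < c ∧ ∀ L : ℕ+, c ≤ averagedCorrelation (torusGraph d L) n β := by
  obtain ⟨b, hb0, hb⟩ := exists_between hβd
  have hev : ∀ᶠ L : ℕ+ in atTop, b ≤ averagedCorrelation (torusGraph d L) n β := by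
    filter_upwards [(tendsto_lower_bound hd).eventually (lt_mem_nhds hb),
      eventually_le_averagedCorrelation (d := d) (n := n) hβ] with L h1 h2
    exact h1.le.trans h2
  obtain ⟨L₀, hL₀⟩ := eventually_atTop.1 hev
  obtain ⟨M, -, hM⟩ := Finset.exists_min_image (Finset.Iic L₀)
    (fun L : ℕ+ => averagedCorrelation (torusGraph d L) n β) ⟨L₀, by simp⟩
  refine ⟨min b (averagedCorrelation (torusGraph d M) n β),
    lt_min hb0 (averagedCorrelation_pos _ _), fun L => ?_⟩
  rcases le_total L L₀ with h | h
  · exact (min_le_right _ _).trans (hM L (by simpa using h))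
  · exact (min_le_left _ _).trans (hL₀ L h)

end LongRangeOrder

theorem mainTheorem1 :
    -- long-range order at low temperature in dimensions at least three, uniformly in `L`
    (∀ d n : ℕ, 3 ≤ d → 1 ≤ n →
      ∃ β₁ : ℝ, 0 < β₁ ∧ ∀ β : ℝ, β₁ ≤ β →
        ∃ c : ℝ, 0 < c ∧ ∀ L : ℕ+, c ≤ averagedCorrelation (torusGraph d L) n β) ∧
    -- the limiting inequality, in the extended reals (the integral may be infinite)
    (∀ d n : ℕ, 1 ≤ d → 1 ≤ n → ∀ β : ℝ, 0 < β →
      (1 : EReal) - (((n : ℝ) / (2 * β) : ℝ) : EReal) * (infraredIntegral d : EReal) ≤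
        liminf (fun L : ℕ+ => ((averagedCorrelation (torusGraph d L) n β : ℝ) : EReal)) atTop) ∧
    -- finiteness and asymptotics of the integral
    (∀ d : ℕ, 3 ≤ d → infraredIntegral d < ⊤) ∧
    (fun d : ℕ => (infraredIntegral d).toReal) ~[atTop] (fun d : ℕ => 1 / (d : ℝ)) := by
  refine ⟨fun d n hd hn => ?_, fun d n _ hn β hβ => ?_, fun d hd => infraredIntegral_lt_top hd, ?_⟩
  · have : NeZero n := ⟨by omega⟩
    have hI : 0 ≤ (infraredIntegral d).toReal := ENNReal.toReal_nonneg
    -- Anything positive above `n I_d / 2` would do; this choice makes `n I_d < 2β` immediate.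
    refine ⟨n * (infraredIntegral d).toReal + 1, by positivity, fun β hβ => ?_⟩
    have hβ0 : 0 < β := lt_of_lt_of_le (by positivity) hβ
    refine exists_pos_le_averagedCorrelation (infraredIntegral_lt_top hd).ne hβ0 ?_
    rw [sub_pos, div_mul_eq_mul_div, div_lt_one (by positivity)]
    linarith
  · have : NeZero n := ⟨by omega⟩
    exact le_liminf_averagedCorrelation hβ
  · rw [isEquivalent_iff_tendsto_one]
    · refine tendsto_mul_toReal_infraredIntegral.congr fun d => ?_
      simp [mul_comm]
    · filter_upwards [eventually_gt_atTop 0] with d hd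
      positivity
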